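/- Let $d\ge 1$, let $\Delta=(a_j)_{j\in J}$ be a finite family of self-adjoint matrices in $\mathcal N=\mathbb M_d=\mathbb M_d(\mathbb C)$, write $|\Delta|=|J|$, and put $$L(x)=\sum_{j}\Big(a_jxa_j-\tfrac12(a_j^2x+xa_j^2)\Big),\qquad T_t=e^{tL}\quad(t\ge 0).$$ Let $\mathcal N_{fix}=\{x\in\mathbb M_d:[a_j,x]=0\ \forall j\}$, let $E_{fix}:\mathcal N\to\mathcal N_{fix}$ be the trace-preserving conditional expectation, and let $\mathcal A=\{x: E_{fix}(x)=0\}$. For $n\ge 1$ set $T_t^{(n)}=\mathrm{id}_{\mathbb M_n}\otimes T_t$ and $E^{(n)}=\mathrm{id}_{\mathbb M_n}\otimes E_{fix}$ on $\mathbb M_n\otimes\mathbb M_d$, and $|||f|||^n_\Delta=\sup_j\|[1_n\otimes a_j,f]\|$ for $f\in\mathbb M_n(\mathcal A)$, where $\|\cdot\|$ is the operator norm. For a linear map $\Phi$ on $\mathbb M_d$ with trace dual $\Phi^*$ put $$C^{cb}_\Delta(\Phi)=\sup_{n\ge1}\ \sup\big\{\|(\mathrm{id}_{\mathbb M_n}\otimes(\Phi^*-\mathrm{id}))f\|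 : f\in\mathbb M_n(\mathcal A),\ |||f|||_\Delta^n\le 1\big\},$$ and let the complete expected length be $$EL^{cb}_\Delta(\mathcal A)=\sup_{n\ge1}\ \sup\big\{\|(\mathrm{id}_{\mathbb M_n}\otimes E_{fix}^*)f-f\| : f\in\mathbb M_n(\mathcal A),\ |||f|||_\Delta^n\le 1\big\}.$$ For density matrices let $D(\rho\|\sigma)=\mathrm{tr}(\rho\log\rho-\rho\log\sigma)$ ($=\infty$ if $\ker\sigma\not\subseteq\ker\rho$), and put $$\sup_\rho D^{cb}(\rho\|E_{fix}\rho)=\sup_{n\ge 1}\ \sup_{\rho}\ D(\rho\|E^{(n)}\rho),$$ the inner supremum being over the density matrices $\rho$ of $\mathbb M_n\otimes\mathbb M_d$. Let $\mathrm{CLSI}(L)\in[0,\infty]$ be the supremum of all $\lambda>0$ such that $$D(T^{(n)}_t\rho\,\|\,E^{(n)}\rho)\le e^{-\lambda t}D(\rho\,\|\,E^{(n)}\rho)$$ for all $n\ge1$, all $t\ge0$ and all density matrices $\rho$ of $\mathbb M_n\otimes\mathbb M_d$ (and $0$ if there is no such $\lambda$). Let $$\mathrm{Ind}^{cb}(\mathcal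 N:\mathcal N_{fix})=\sup_{n\ge1}\ \inf\big\{\alpha>0:\rho\le\alpha\,(\mathrm{id}_{\mathbb M_n}\otimes E_{fix}^*)\rho\ \text{ for all positive }\rho\in \mathbb M_n\otimes\mathbb M_d\big\}.$$ Then, in $[0,\infty]$ (with $c/\infty=0$ for finite $c$, $c/0=\infty$ for $c>0$, and $0/0=0$), $$EL^{cb}_\Delta(\mathcal A)=C^{cb}_\Delta(E_{fix})\le 4\sqrt{\frac{2|\Delta|\,\sup_\rho D^{cb}(\rho\|E_{fix}\rho)}{\mathrm{CLSI}(L)}}\le 4\sqrt{\frac{2|\Delta|\,\log\mathrm{Ind}^{cb}(\mathcal N:\mathcal N_{fix})}{\mathrm{CLSI}(L)}}.$$ -/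

import Mathlib

open scoped Matrix Kronecker ENNReal ComplexOrder
-- `‖X‖` for a matrix `X` is the operator norm on the Hilbert space `ℂᵐ`.
open scoped Matrix.Norms.L2Operator

noncomputable section

namespace LipschitzComplexity

variable {d : ℕ} {ι : Type*}

/-! ### The symmetric Lindbladian, its semigroup, and the fixed point algebra -/

/-- The symmetric Lindbladian `L x = ∑ j, (a j x a j - (a j² x + x a j²) / 2)`. -/
def lindbladian [Fintype ι] (a : ι → Matrix (Fin d) (Fin d) ℂ) :
    Matrix (Fin d) (Fin d) ℂ →ₗ[ℂ] Matrix (Fin d) (Fin d) ℂ where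
  toFun x := ∑ j, (a j * x * a j - (1 / 2 : ℂ) • (a j ^ 2 * x + x * a j ^ 2))
  map_add' x y := by
    rw [← Finset.sum_add_distrib]
    refine Finset.sum_congr rfl fun j _ => ?_
    simp only [mul_add, add_mul, smul_add]
    abel
  map_smul' c x := by
    simp only [RingHom.id_apply, Finset.smul_sum]
    refine Finset.sum_congr rfl fun j _ => ?_
    simp only [mul_smul_comm, smul_mul_assoc, smul_sub, smul_add, smul_comm c (1 / 2 : ℂ)]

/-- The Lindbladian as an element of the Banach algebra of linear maps on `M_d`. -/
def lindbladianCLM [Fintype ι] (a : ι → Matrix (Fin d) (Fin d) ℂ) :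
    Matrix (Fin d) (Fin d) ℂ →L[ℂ] Matrix (Fin d) (Fin d) ℂ :=
  LinearMap.toContinuousLinearMap (lindbladian a)

/-- The semigroup `T_t = exp (t L)`. -/
def semigroup [Fintype ι] (a : ι → Matrix (Fin d) (Fin d) ℂ) (t : ℝ) :
    Matrix (Fin d) (Fin d) ℂ →ₗ[ℂ] Matrix (Fin d) (Fin d) ℂ :=
  (NormedSpace.exp (t • lindbladianCLM a)).toLinearMap

/-- The fixed point algebra `{x | [a j, x] = 0 for all j}`, as a subspace. -/
def fixedAlgebra (a : ι → Matrix (Fin d) (Fin d) ℂ) :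
    Submodule ℂ (Matrix (Fin d) (Fin d) ℂ) where
  carrier := {x | ∀ j, a j * x - x * a j = 0}
  add_mem' {x y} hx hy j := by
    have h : a j * (x + y) - (x + y) * a j
        = (a j * x - x * a j) + (a j * y - y * a j) := by noncomm_ring
    rw [h, hx j, hy j, add_zero]
  zero_mem' j := by simp
  smul_mem' c x hx j := by
    rw [mul_smul_comm, smul_mul_assoc, ← smul_sub, hx j, smul_zero]

/-- Matrices as vectors of a Hilbert space whose inner product is the
Hilbert–Schmidt inner product `tr (x* y)`. -/
def hsEquiv (d : ℕ) :
    Matrix (Fin d) (Fin d) ℂ ≃ₗ[ℂ] EuclideanSpace ℂ (Fin d × Fin d) :=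
  (LinearEquiv.curry ℂ ℂ (Fin d) (Fin d)).symm ≪≫ₗ
    (WithLp.linearEquiv 2 ℂ (Fin d × Fin d → ℂ)).symm

/-- The trace-preserving conditional expectation `E_fix` onto the fixed point algebra: the
orthogonal projection with respect to the inner product `tr (x* y)`. -/
def condExpFix (a : ι → Matrix (Fin d) (Fin d) ℂ) :
    Matrix (Fin d) (Fin d) ℂ →ₗ[ℂ] Matrix (Fin d) (Fin d) ℂ :=
  (hsEquiv d).symm.toLinearMap ∘ₗ
    (((fixedAlgebra a).map (hsEquiv d).toLinearMap).starProjection :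
      EuclideanSpace ℂ (Fin d × Fin d) →ₗ[ℂ] EuclideanSpace ℂ (Fin d × Fin d)) ∘ₗ
    (hsEquiv d).toLinearMap

theorem inner_hsEquiv (x y : Matrix (Fin d) (Fin d) ℂ) :
    inner ℂ (hsEquiv d x) (hsEquiv d y) = (xᴴ * y).trace := by
  simp only [PiLp.inner_apply, Fintype.sum_prod_type, Matrix.trace, Matrix.diag_apply,
    Matrix.mul_apply, Matrix.conjTranspose_apply]
  rw [Finset.sum_comm]
  refine Finset.sum_congr rfl fun k _ => Finset.sum_congr rfl fun l _ => ?_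
  exact mul_comm (y l k) (starRingEnd ℂ (x l k))

theorem condExpFix_mem (a : ι → Matrix (Fin d) (Fin d) ℂ) (x : Matrix (Fin d) (Fin d) ℂ) :
    condExpFix a x ∈ fixedAlgebra a := by
  have h := Submodule.starProjection_apply_mem
    ((fixedAlgebra a).map (hsEquiv d).toLinearMap) (hsEquiv d x)
  obtain ⟨y, hy, hyx⟩ := h
  have : condExpFix a x = y := by
    have h2 : hsEquiv d (condExpFix a x) = hsEquiv d y := by
      simp only [condExpFix, LinearMap.comp_apply, LinearEquiv.coe_coe,
        LinearEquiv.apply_symm_apply]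
      exact hyx.symm
    exact (hsEquiv d).injective h2
  rwa [this]

/-- The property that characterises the trace-preserving conditional expectation:
`tr (y* E(x)) = tr (y* x)` for all `y` in the fixed point algebra. -/
theorem trace_mul_condExpFix (a : ι → Matrix (Fin d) (Fin d) ℂ)
    (x y : Matrix (Fin d) (Fin d) ℂ) (hy : y ∈ fixedAlgebra a) :
    (yᴴ * condExpFix a x).trace = (yᴴ * x).trace := by
  have h := Submodule.starProjection_inner_eq_zero
    (K := (fixedAlgebra a).map (hsEquiv d).toLinearMap) (hsEquiv d x) (hsEquiv d y)
    ⟨y, hy, rfl⟩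
  rw [← inner_conj_symm, map_eq_zero] at h
  have h2 : hsEquiv d (condExpFix a x)
      = ((fixedAlgebra a).map (hsEquiv d).toLinearMap).starProjection (hsEquiv d x) := by
    simp [condExpFix]
  rw [← h2, ← map_sub, inner_hsEquiv, mul_sub, Matrix.trace_sub, sub_eq_zero] at h
  exact h.symm

/-! ### Amplifications and dual maps -/

/-- The amplification `id_n ⊗ Φ` on `M_n(M_d)`, the matrices indexed by `Fin n × Fin d`. -/
def amplify (n : ℕ) (Φ : Matrix (Fin d) (Fin d) ℂ →ₗ[ℂ] Matrix (Fin d) (Fin d) ℂ) :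
    Matrix (Fin n × Fin d) (Fin n × Fin d) ℂ →ₗ[ℂ]
      Matrix (Fin n × Fin d) (Fin n × Fin d) ℂ where
  toFun x := Matrix.of fun p q =>
    Φ (x.submatrix (fun k => (p.1, k)) (fun l => (q.1, l))) p.2 q.2
  map_add' x y := by
    ext p q
    simp [Matrix.submatrix_add]
  map_smul' c x := by
    ext p q
    simp [Matrix.submatrix_smul]

theorem amplify_kronecker (n : ℕ)
    (Φ : Matrix (Fin d) (Fin d) ℂ →ₗ[ℂ] Matrix (Fin d) (Fin d) ℂ)
    (u : Matrix (Fin n) (Fin n) ℂ) (x : Matrix (Fin d) (Fin d) ℂ) :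
    amplify n Φ (u ⊗ₖ x) = u ⊗ₖ Φ x := by
  ext p q
  have h : (u ⊗ₖ x).submatrix (fun k => (p.1, k)) (fun l => (q.1, l)) = u p.1 q.1 • x := by
    ext k l
    simp
  simp [amplify, h]

/-- The dual `Φ*` of a linear map with respect to the trace. -/
def traceDual (Φ : Matrix (Fin d) (Fin d) ℂ →ₗ[ℂ] Matrix (Fin d) (Fin d) ℂ) :
    Matrix (Fin d) (Fin d) ℂ →ₗ[ℂ] Matrix (Fin d) (Fin d) ℂ where
  toFun x := Matrix.of fun k l => (x * Φ (Matrix.single l k 1)).trace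
  map_add' x y := by
    ext k l
    simp [add_mul]
  map_smul' c x := by
    ext k l
    simp

theorem trace_traceDual_mul
    (Φ : Matrix (Fin d) (Fin d) ℂ →ₗ[ℂ] Matrix (Fin d) (Fin d) ℂ)
    (x ρ : Matrix (Fin d) (Fin d) ℂ) :
    (traceDual Φ x * ρ).trace = (x * Φ ρ).trace := by
  have h : x * Φ ρ = ∑ l, ∑ k, ρ l k • (x * Φ (Matrix.single l k 1)) := by
    conv_lhs => rw [Matrix.matrix_eq_sum_single ρ]
    simp only [map_sum, Finset.mul_sum]
    refine Finset.sum_congr rfl fun l _ => Finset.sum_congr rfl fun k _ => ?_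
    rw [← mul_smul_comm, ← map_smul, Matrix.smul_single, smul_eq_mul, mul_one]
  rw [h]
  simp only [Matrix.trace_sum, Matrix.trace_smul, smul_eq_mul]
  simp only [Matrix.trace, Matrix.diag_apply, Matrix.mul_apply (M := traceDual Φ x)]
  rw [Finset.sum_comm]
  refine Finset.sum_congr rfl fun l _ => Finset.sum_congr rfl fun k _ => ?_
  simp [traceDual, Matrix.trace, mul_comm]

/-! ### Complete complexity and expected length -/

/-- The amplified Lipschitz norm `sup_j ‖[1_n ⊗ a j, f]‖`. -/
def lipNorm (a : ι → Matrix (Fin d) (Fin d) ℂ) (n : ℕ)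
    (f : Matrix (Fin n × Fin d) (Fin n × Fin d) ℂ) : ℝ :=
  ⨆ j, ‖((1 : Matrix (Fin n) (Fin n) ℂ) ⊗ₖ a j) * f - f * ((1 : Matrix (Fin n) (Fin n) ℂ) ⊗ₖ a j)‖

/-- The complete complexity of a channel `Φ`: the supremum over `n ≥ 1` of the norms of
`id_n ⊗ (Φ* - id)` from `M_n(𝓐)` with the amplified Lipschitz norm to `M_n(M_d)` with the
operator norm. Here `𝓐` is the kernel of `E_fix`, so `M_n(𝓐)` is that of `id_n ⊗ E_fix`. -/
def completeComplexity (a : ι → Matrix (Fin d) (Fin d) ℂ)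
    (Φ : Matrix (Fin d) (Fin d) ℂ →ₗ[ℂ] Matrix (Fin d) (Fin d) ℂ) : ℝ≥0∞ :=
  ⨆ (n : ℕ) (_ : 1 ≤ n) (f : Matrix (Fin n × Fin d) (Fin n × Fin d) ℂ)
    (_ : amplify n (condExpFix a) f = 0) (_ : lipNorm a n f ≤ 1),
    ‖amplify n (traceDual Φ - LinearMap.id) f‖ₑ

/-- The complete expected length of the mean-zero Lipschitz space `𝓐`: the supremum over
`n ≥ 1` of the norms of `id_n ⊗ E_fix* - id_n ⊗ id` on `M_n(𝓐)`. -/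
def expectedLength (a : ι → Matrix (Fin d) (Fin d) ℂ) : ℝ≥0∞ :=
  ⨆ (n : ℕ) (_ : 1 ≤ n) (f : Matrix (Fin n × Fin d) (Fin n × Fin d) ℂ)
    (_ : amplify n (condExpFix a) f = 0) (_ : lipNorm a n f ≤ 1),
    ‖amplify n (traceDual (condExpFix a)) f - f‖ₑ

/-! ### Relative entropy, CLSI constant, index -/

/-- Density matrices. -/
def IsState {m : Type*} [Fintype m] (ρ : Matrix m m ℂ) : Prop :=
  ρ.PosSemidef ∧ ρ.trace = 1

open Classical in
/-- The relative entropy `D(ρ‖σ) = tr (ρ log ρ - ρ log σ)` of density matrices, and `∞` if the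
kernel of `σ` is not contained in that of `ρ`. The logarithm is the functional calculus with
`log 0 = 0`. The trace is real and nonnegative for density matrices `ρ`, `σ` (Klein). -/
def relEntropy {m : Type*} [Fintype m] [DecidableEq m] (ρ σ : Matrix m m ℂ) : ℝ≥0∞ :=
  if LinearMap.ker σ.mulVecLin ≤ LinearMap.ker ρ.mulVecLin then
    ENNReal.ofReal (ρ * (cfc Real.log ρ - cfc Real.log σ)).trace.re
  else ∞

/-- `sup_ρ D^cb(ρ‖E_fix ρ)`: the supremum of `D(ρ‖(id_n ⊗ E_fix) ρ)` over `n ≥ 1` and all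
states `ρ` on `M_n(M_d)`. -/
def maxRelEntropy (a : ι → Matrix (Fin d) (Fin d) ℂ) : ℝ≥0∞ :=
  ⨆ (n : ℕ) (_ : 1 ≤ n) (ρ : Matrix (Fin n × Fin d) (Fin n × Fin d) ℂ) (_ : IsState ρ),
    relEntropy ρ (amplify n (condExpFix a) ρ)

/-- The semigroup `id_n ⊗ T_t` satisfies the modified logarithmic Sobolev inequality with
constant `lam`. -/
def SatisfiesMLSI [Fintype ι] (a : ι → Matrix (Fin d) (Fin d) ℂ) (n : ℕ) (lam : ℝ) : Prop :=
  ∀ t : ℝ, 0 ≤ t → ∀ ρ : Matrix (Fin n × Fin d) (Fin n × Fin d) ℂ, IsState ρ →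
    relEntropy (amplify n (semigroup a t) ρ) (amplify n (condExpFix a) ρ) ≤
      ENNReal.ofReal (Real.exp (-lam * t)) * relEntropy ρ (amplify n (condExpFix a) ρ)

/-- The best constant `CLSI(L) ∈ [0, ∞]` in the complete modified logarithmic Sobolev
inequality. -/
def clsi [Fintype ι] (a : ι → Matrix (Fin d) (Fin d) ℂ) : ℝ≥0∞ :=
  ⨆ (lam : ℝ) (_ : 0 < lam) (_ : ∀ n : ℕ, 1 ≤ n → SatisfiesMLSI a n lam), ENNReal.ofReal lam

/-- The index of `M_n(𝓝_fix)` in `M_n(M_d)`: the infimum of the `α > 0` such that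
`ρ ≤ α (id_n ⊗ E_fix*) ρ` for all positive `ρ`. -/
def index (a : ι → Matrix (Fin d) (Fin d) ℂ) (n : ℕ) : ℝ≥0∞ :=
  ⨅ (α : ℝ) (_ : 0 < α)
    (_ : ∀ ρ : Matrix (Fin n × Fin d) (Fin n × Fin d) ℂ, ρ.PosSemidef →
      ((α : ℂ) • amplify n (traceDual (condExpFix a)) ρ - ρ).PosSemidef),
    ENNReal.ofReal α

/-- The complete index `Ind^cb(𝓝 : 𝓝_fix)`. -/
def completeIndex (a : ι → Matrix (Fin d) (Fin d) ℂ) : ℝ≥0∞ :=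
  ⨆ (n : ℕ) (_ : 1 ≤ n), index a n

end LipschitzComplexity

end

/-!
The conditional expectation `E_fix` is self-dual for the trace, so on the kernel of `id_n ⊗ E_fix`
the complexity of `E_fix` and the expected length are both the largest norm of a mean zero `f` whose
commutators with `b j = 1 ⊗ a j` have norm at most one.

Such an `f` is tested against a faithful state `ρ` evolving as `ρ_t = (id_n ⊗ T_t) ρ`. In an
eigenbasis of `ρ_t` with eigenvalues `p k`, the pairing of a contraction with `[b j, ρ_t]` is a sum
with weights `p k - p l`, and the entropy production is a sum with weights
`(p k - p l) (log p k - log p l)`. As the logarithmic mean is at most the arithmetic one, the speed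
of `tr (f ρ_t)` is at most a constant times the square root of the entropy production
(`norm_trace_mul_commutator_le`, `norm_trace_mul_generator_le`). Exponential decay of the entropy at
a rate `λ` makes this integrable in time (`norm_sub_le_of_exponential_decay`), and the result is
`|tr (f ρ)|² λ ≤ 2 |Δ| D(ρ‖E ρ)` (`norm_trace_mul_sq_mul_le`). Instead of the convergence of `ρ_t`
to `E ρ`, the argument uses that `f = L g` for some `g`, so that `tr (f ρ_t)` is the derivative of
the bounded function `tr (g ρ_t)`. The norm of `f` is at most four times its largest value on
states, by polarization.

The calculus of `tr h(ρ_t)` rests on Klein's inequality: for convex `h` with continuous derivative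
it squeezes the increments (`hasDerivWithinAt_trace_cfc`). Applied to `h x = x log x` this gives the
entropy production, and applied to `h x = (min (x - c) 0) ^ 2` it shows that the semigroup preserves
lower bounds on the spectrum, in particular positivity.

Finally `ρ ≤ α E ρ` gives `D(ρ‖E ρ) ≤ log α` by operator monotonicity of the logarithm.
-/

namespace LipschitzComplexity
noncomputable section
variable {m : Type*} [Fintype m] [DecidableEq m]

/-! ### Trace identities in eigenbases -/

theorem continuousOn_spectrum (A : Matrix m m ℂ) (f : ℝ → ℝ) :
    ContinuousOn f (spectrum ℝ A) := by
  rw [continuousOn_iff_continuous_domRestrict]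
  have := A.finite_real_spectrum.to_subtype
  exact continuous_of_discreteTopology

/-- The trace of `f(A) M g(B) N` as a double sum over the eigenvalues of `A` and `B`, weighted by
the entries of `M` and `N` in the two eigenbases. -/
theorem trace_cfc_mul_mul_cfc_mul {A B : Matrix m m ℂ} (hA : A.IsHermitian) (hB : B.IsHermitian)
    (f g : ℝ → ℝ) (M N : Matrix m m ℂ) :
    (cfc f A * M * cfc g B * N).trace =
      ∑ k, ∑ l, ((f (hA.eigenvalues k) : ℂ) * (g (hB.eigenvalues l) : ℂ)) *
        (((hA.eigenvectorUnitary : Matrix m m ℂ)ᴴ * M * hB.eigenvectorUnitary) k l *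
        ((hB.eigenvectorUnitary : Matrix m m ℂ)ᴴ * N * hA.eigenvectorUnitary) l k) := by
  rw [hA.cfc_eq, hB.cfc_eq]
  simp only [Matrix.IsHermitian.cfc, Unitary.conjStarAlgAut_apply, Matrix.star_eq_conjTranspose]
  generalize (hA.eigenvectorUnitary : Matrix m m ℂ) = U
  generalize (hB.eigenvectorUnitary : Matrix m m ℂ) = V
  have key : ∀ D1 D2 : Matrix m m ℂ, (U * D1 * Uᴴ * M * (V * D2 * Vᴴ) * N).trace
      = ((D1 * (Uᴴ * M * V)) * (D2 * (Vᴴ * N * U))).trace := by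
    intro D1 D2
    rw [show U * D1 * Uᴴ * M * (V * D2 * Vᴴ) * N = U * (D1 * Uᴴ * M * (V * D2 * Vᴴ) * N) by
      simp only [mul_assoc], Matrix.trace_mul_comm]
    simp only [mul_assoc]
  rw [key, Matrix.trace]
  refine Finset.sum_congr rfl fun k _ => ?_
  rw [Matrix.diag_apply, Matrix.mul_apply]
  refine Finset.sum_congr rfl fun l _ => ?_
  rw [Matrix.diagonal_mul, Matrix.diagonal_mul]
  simp only [Function.comp, RCLike.ofReal_eq_complex_ofReal]
  ring

theorem re_trace_cfc_mul_mul_cfc_mul_conjTranspose {A B : Matrix m m ℂ} (hA : A.IsHermitian)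
    (hB : B.IsHermitian) (f g : ℝ → ℝ) (M : Matrix m m ℂ) :
    (cfc f A * M * cfc g B * Mᴴ).trace.re =
      ∑ k, ∑ l, f (hA.eigenvalues k) * g (hB.eigenvalues l) *
        ‖((hA.eigenvectorUnitary : Matrix m m ℂ)ᴴ * M * hB.eigenvectorUnitary) k l‖ ^ 2 := by
  rw [trace_cfc_mul_mul_cfc_mul hA hB, Complex.re_sum]
  refine Finset.sum_congr rfl fun k _ => ?_
  rw [Complex.re_sum]
  refine Finset.sum_congr rfl fun l _ => ?_
  have h : ((hB.eigenvectorUnitary : Matrix m m ℂ)ᴴ * Mᴴ * hA.eigenvectorUnitary) l k =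
      star (((hA.eigenvectorUnitary : Matrix m m ℂ)ᴴ * M * hB.eigenvectorUnitary) k l) := by
    rw [← Matrix.conjTranspose_apply]
    simp only [Matrix.conjTranspose_mul, Matrix.conjTranspose_conjTranspose, mul_assoc]
  rw [h, Complex.star_def, Complex.mul_conj, Complex.normSq_eq_norm_sq]
  norm_cast

theorem trace_cfc_mul_eq_sum {A : Matrix m m ℂ} (hA : A.IsHermitian) (f : ℝ → ℝ)
    (M : Matrix m m ℂ) :
    (cfc f A * M).trace = ∑ k, (f (hA.eigenvalues k) : ℂ) *
      ((hA.eigenvectorUnitary : Matrix m m ℂ)ᴴ * M * hA.eigenvectorUnitary) k k := by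
  rw [hA.cfc_eq]
  simp only [Matrix.IsHermitian.cfc, Unitary.conjStarAlgAut_apply, Matrix.star_eq_conjTranspose]
  generalize (hA.eigenvectorUnitary : Matrix m m ℂ) = U
  rw [mul_assoc, mul_assoc, Matrix.trace_mul_comm, mul_assoc, Matrix.trace]
  refine Finset.sum_congr rfl fun k _ => ?_
  rw [Matrix.diag_apply, Matrix.diagonal_mul]
  rfl

/-- Klein's inequality: a tangent line inequality for scalars gives one for the trace. -/
theorem klein_inequality {A B : Matrix m m ℂ} (hA : A.IsHermitian) (hB : B.IsHermitian)
    {s : Set ℝ} (hAs : spectrum ℝ A ⊆ s) (hBs : spectrum ℝ B ⊆ s) {h g : ℝ → ℝ}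
    (hg : ∀ x ∈ s, ∀ y ∈ s, (x - y) * g y ≤ h x - h y) :
    ((A - B) * cfc g B).trace.re ≤ (cfc h A).trace.re - (cfc h B).trace.re := by
  have hA' : IsSelfAdjoint A := hA
  have hB' : IsSelfAdjoint B := hB
  have e1 := re_trace_cfc_mul_mul_cfc_mul_conjTranspose hA hB h (fun _ => 1) 1
  have e2 := re_trace_cfc_mul_mul_cfc_mul_conjTranspose hA hB (fun _ => 1) h 1
  have e3 := re_trace_cfc_mul_mul_cfc_mul_conjTranspose hA hB id g 1
  have e4 := re_trace_cfc_mul_mul_cfc_mul_conjTranspose hA hB (fun _ => 1) (fun y => y * g y) 1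
  have c1 : ∀ {C : Matrix m m ℂ}, IsSelfAdjoint C → cfc (fun _ => (1 : ℝ)) C = 1 := fun hC => by
    rw [cfc_const_one ℝ _ hC]
  have hgB := continuousOn_spectrum B g
  rw [c1 hB'] at e1
  rw [c1 hA'] at e2 e4
  rw [cfc_id ℝ A hA'] at e3
  rw [cfc_mul (fun y => y) g B (by fun_prop) hgB, cfc_id' ℝ B hB'] at e4
  simp only [Matrix.conjTranspose_one, mul_one, one_mul] at e1 e2 e3 e4
  rw [sub_mul, Matrix.trace_sub, Complex.sub_re, e1, e2, e3, e4, ← Finset.sum_sub_distrib,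
    ← Finset.sum_sub_distrib]
  refine Finset.sum_le_sum fun k _ => ?_
  rw [← Finset.sum_sub_distrib, ← Finset.sum_sub_distrib]
  refine Finset.sum_le_sum fun l _ => ?_
  have hkl := hg _ (hAs (hA.eigenvalues_mem_spectrum_real k)) _
    (hBs (hB.eigenvalues_mem_spectrum_real l))
  set w := ‖((hA.eigenvectorUnitary : Matrix m m ℂ)ᴴ * hB.eigenvectorUnitary) k l‖ ^ 2
  have hw : 0 ≤ w := sq_nonneg _
  simp only [id]
  linarith [mul_le_mul_of_nonneg_right hkl hw]

/-! ### Trace estimates -/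

theorem norm_entry_le_l2OpNorm (M : Matrix m m ℂ) (i j : m) : ‖M i j‖ ≤ ‖M‖ := by
  have h := M.l2_opNorm_mulVec (EuclideanSpace.single j 1)
  have h2 := PiLp.norm_apply_le (WithLp.toLp 2 (M *ᵥ (EuclideanSpace.single j (1 : ℂ)).ofLp)) i
  simp only [PiLp.norm_single, norm_one, mul_one] at h
  refine le_trans (le_of_eq ?_) (h2.trans h)
  simp

/-- Duality of the trace and operator norms, for a positive matrix. -/
theorem norm_trace_mul_le {x : Matrix m m ℂ} (hx : x.PosSemidef) (M : Matrix m m ℂ) :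
    ‖(x * M).trace‖ ≤ ‖M‖ * x.trace.re := by
  have hxs : IsSelfAdjoint x := hx.isHermitian
  have h1 := trace_cfc_mul_eq_sum hx.isHermitian id M
  rw [cfc_id ℝ x hxs] at h1
  rw [h1, hx.isHermitian.trace_eq_sum_eigenvalues, Complex.re_sum, Finset.mul_sum]
  refine (norm_sum_le _ _).trans (Finset.sum_le_sum fun k _ => ?_)
  have h0 : 0 ≤ hx.isHermitian.eigenvalues k := hx.eigenvalues_nonneg k
  rw [norm_mul, id, Complex.norm_real, Real.norm_of_nonneg h0, mul_comm]
  refine mul_le_mul_of_nonneg_right ((norm_entry_le_l2OpNorm _ k k).trans ?_) h0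
  rw [CStarRing.norm_mul_coe_unitary, ← Matrix.star_eq_conjTranspose, ← Unitary.coe_star,
    CStarRing.norm_coe_unitary_mul]

theorem trace_mul_nonneg {x y : Matrix m m ℂ} (hx : x.PosSemidef) (hy : y.PosSemidef) :
    0 ≤ (x * y).trace.re := by
  have hxs : IsSelfAdjoint x := hx.isHermitian
  have h1 := trace_cfc_mul_eq_sum hx.isHermitian id y
  rw [cfc_id ℝ x hxs] at h1
  rw [h1, Complex.re_sum]
  refine Finset.sum_nonneg fun k _ => ?_
  have h2 := (hy.conjTranspose_mul_mul_same
    (hx.isHermitian.eigenvectorUnitary : Matrix m m ℂ)).diag_nonneg (i := k)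
  rw [id, Complex.re_ofReal_mul]
  exact mul_nonneg (hx.eigenvalues_nonneg k) (Complex.le_def.1 h2).1

/-- The logarithmic mean is at most the arithmetic mean. -/
theorem sub_sq_le_mul_log_sub_log {p q : ℝ} (hp : 0 < p) (hq : 0 < q) :
    (p - q) ^ 2 ≤ (p + q) / 2 * ((p - q) * (Real.log p - Real.log q)) := by
  wlog h : q ≤ p generalizing p q
  · have := this hq hp (le_of_not_ge h)
    nlinarith
  have h1 := Real.sum_range_le_log_div (x := (p - q) / (p + q))
    (div_nonneg (by linarith) (by linarith)) ((div_lt_one (by linarith)).2 (by linarith)) 1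
  have h2 : (1 + (p - q) / (p + q)) / (1 - (p - q) / (p + q)) = p / q := by
    have hpq : p + q ≠ 0 := by linarith
    have h3 : 1 + (p - q) / (p + q) = 2 * p / (p + q) := by field_simp; ring
    have h4 : 1 - (p - q) / (p + q) = 2 * q / (p + q) := by field_simp; ring
    rw [h3, h4, div_div_div_cancel_right₀ hpq, mul_div_mul_left _ _ two_ne_zero]
  rw [h2, Real.log_div hp.ne' hq.ne'] at h1
  simp only [Finset.range_one, Finset.sum_singleton, mul_zero, zero_add, pow_one,
    Nat.cast_zero, div_one] at h1
  rw [div_le_iff₀ (by linarith)] at h1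
  nlinarith [mul_le_mul_of_nonneg_left h1 (sub_nonneg.2 h)]

/-! ### Dissipation and commutators -/

/-- The dissipator `b x b - (b² x + x b²) / 2 = -[b, [b, x]] / 2` of a single matrix. -/
def dissipator (b x : Matrix m m ℂ) : Matrix m m ℂ :=
  b * x * b - (1 / 2 : ℂ) • (b ^ 2 * x + x * b ^ 2)

/-- In an eigenbasis of `x` the pairing of `f(x)` with the dissipator is a sum of products of
differences, which has a sign for monotone `f`; for `f = log` it is the entropy production. -/
theorem re_trace_cfc_mul_dissipator {x b : Matrix m m ℂ} (hx : x.IsHermitian) (hb : b.IsHermitian)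
    (f : ℝ → ℝ) :
    (cfc f x * dissipator b x).trace.re = -(1 / 2) * ∑ k, ∑ l,
      (f (hx.eigenvalues k) - f (hx.eigenvalues l)) * (hx.eigenvalues k - hx.eigenvalues l) *
        ‖((hx.eigenvectorUnitary : Matrix m m ℂ)ᴴ * b * hx.eigenvectorUnitary) k l‖ ^ 2 := by
  have hx' : IsSelfAdjoint x := hx
  have hfx := continuousOn_spectrum x f
  have e1 := re_trace_cfc_mul_mul_cfc_mul_conjTranspose hx hx f id b
  have e2 := re_trace_cfc_mul_mul_cfc_mul_conjTranspose hx hx (fun y => f y * y) (fun _ => 1) b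
  have e3 := re_trace_cfc_mul_mul_cfc_mul_conjTranspose hx hx (fun y => y * f y) (fun _ => 1) b
  rw [hb.eq, cfc_id ℝ x hx'] at e1
  rw [cfc_mul f (fun y => y) x hfx (by fun_prop), cfc_id' ℝ x hx', cfc_const_one ℝ x hx', hb.eq,
    mul_one] at e2
  rw [cfc_mul (fun y => y) f x (by fun_prop) hfx, cfc_id' ℝ x hx', cfc_const_one ℝ x hx', hb.eq,
    mul_one] at e3
  have e4 : (cfc f x * (b ^ 2 * x)).trace = (x * cfc f x * b * b).trace := by
    rw [← mul_assoc, Matrix.trace_mul_comm, pow_two]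
    simp only [mul_assoc]
  have e5 : (cfc f x * (x * b ^ 2)).trace = (cfc f x * x * b * b).trace := by
    rw [pow_two]
    simp only [mul_assoc]
  have e6 : (cfc f x * (b * x * b)).trace = (cfc f x * b * x * b).trace := by
    simp only [mul_assoc]
  set W := fun k l =>
    ‖((hx.eigenvectorUnitary : Matrix m m ℂ)ᴴ * b * hx.eigenvectorUnitary) k l‖ ^ 2
  have hW : ∀ k l, W k l = W l k := by
    intro k l
    have : ((hx.eigenvectorUnitary : Matrix m m ℂ)ᴴ * b * hx.eigenvectorUnitary) k l =
        star (((hx.eigenvectorUnitary : Matrix m m ℂ)ᴴ * b * hx.eigenvectorUnitary) l k) := by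
      rw [← Matrix.conjTranspose_apply]
      simp only [Matrix.conjTranspose_mul, Matrix.conjTranspose_conjTranspose, mul_assoc, hb.eq]
    simp only [W, this, norm_star]
  rw [dissipator, mul_sub, mul_smul_comm, mul_add, Matrix.trace_sub, Matrix.trace_smul,
    Matrix.trace_add, e4, e5, e6, Complex.sub_re, smul_eq_mul,
    show (1 / 2 : ℂ) = ((1 / 2 : ℝ) : ℂ) by norm_num, Complex.re_ofReal_mul, Complex.add_re,
    e1, e2, e3]
  have s1 : ∑ k, ∑ l, f (hx.eigenvalues l) * hx.eigenvalues l * W k l =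
      ∑ k, ∑ l, f (hx.eigenvalues k) * hx.eigenvalues k * W k l := by
    rw [Finset.sum_comm]
    simp only [hW]
  have s2 : ∑ k, ∑ l, f (hx.eigenvalues l) * hx.eigenvalues k * W k l =
      ∑ k, ∑ l, f (hx.eigenvalues k) * hx.eigenvalues l * W k l := by
    rw [Finset.sum_comm]
    simp only [hW]
  have s3 : ∑ k, ∑ l, (f (hx.eigenvalues k) - f (hx.eigenvalues l)) *
      (hx.eigenvalues k - hx.eigenvalues l) * W k l =
      ∑ k, ∑ l, f (hx.eigenvalues k) * hx.eigenvalues k * W k l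
      + ∑ k, ∑ l, f (hx.eigenvalues l) * hx.eigenvalues l * W k l
      - ∑ k, ∑ l, f (hx.eigenvalues l) * hx.eigenvalues k * W k l
      - ∑ k, ∑ l, f (hx.eigenvalues k) * hx.eigenvalues l * W k l := by
    simp only [← Finset.sum_add_distrib, ← Finset.sum_sub_distrib]
    refine Finset.sum_congr rfl fun k _ => Finset.sum_congr rfl fun l _ => ?_
    ring
  have s4 : ∑ k, ∑ l, hx.eigenvalues k * f (hx.eigenvalues k) * 1 * W k l =
      ∑ k, ∑ l, f (hx.eigenvalues k) * hx.eigenvalues k * W k l :=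
    Finset.sum_congr rfl fun k _ => Finset.sum_congr rfl fun l _ => by ring
  simp only [W] at *
  rw [s3, s1, s2, s4]
  simp only [id, mul_one]
  ring

/-- Testing a commutator `[b, x]` against a contraction is controlled by the mass and the entropy
dissipation of `x`. -/
theorem norm_trace_mul_commutator_le {x b F : Matrix m m ℂ} (hx : x.PosDef) (hb : b.IsHermitian)
    (hF : ‖F‖ ≤ 1) {β : ℝ} (hβ : 0 < β) :
    ‖(F * (b * x - x * b)).trace‖ ≤
      β / 2 * x.trace.re - (1 / β) * (cfc Real.log x * dissipator b x).trace.re := by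
  have hxh := hx.isHermitian
  have hx' : IsSelfAdjoint x := hxh
  rw [re_trace_cfc_mul_dissipator hxh hb]
  have a1 := trace_cfc_mul_mul_cfc_mul hxh hxh (fun _ => 1) id F b
  have a2 := trace_cfc_mul_mul_cfc_mul hxh hxh id (fun _ => 1) F b
  have a3 := re_trace_cfc_mul_mul_cfc_mul_conjTranspose hxh hxh id (fun _ => 1) F
  have a4 := re_trace_cfc_mul_mul_cfc_mul_conjTranspose hxh hxh (fun _ => 1) id F
  rw [cfc_id ℝ x hx', cfc_const_one ℝ x hx'] at a1 a2 a3 a4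
  simp only [Complex.ofReal_one, one_mul, mul_one, id] at a1 a2 a3 a4
  have hxx := norm_trace_mul_le hx.posSemidef
  have htr : 0 ≤ x.trace.re := (Complex.le_def.1 hx.posSemidef.trace_nonneg).1
  have hFF : ‖Fᴴ‖ ≤ 1 := by rwa [Matrix.l2_opNorm_conjTranspose]
  have b3 : (x * F * Fᴴ).trace.re ≤ x.trace.re := by
    rw [mul_assoc]
    refine (Complex.re_le_norm _).trans ((hxx _).trans ?_)
    exact mul_le_of_le_one_left htr ((norm_mul_le _ _).trans (mul_le_one₀ hF (norm_nonneg _) hFF))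
  have b4 : (F * x * Fᴴ).trace.re ≤ x.trace.re := by
    rw [mul_assoc, Matrix.trace_mul_comm, mul_assoc]
    refine (Complex.re_le_norm _).trans ((hxx _).trans ?_)
    exact mul_le_of_le_one_left htr ((norm_mul_le _ _).trans (mul_le_one₀ hFF (norm_nonneg _) hF))
  have e0 : (F * (b * x - x * b)).trace = (x * F * b).trace - (F * x * b).trace := by
    rw [mul_sub, Matrix.trace_sub, ← mul_assoc F b x, Matrix.trace_mul_comm (F * b) x]
    simp only [mul_assoc]
  rw [e0, a1, a2, ← Finset.sum_sub_distrib]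
  rw [a3] at b3
  rw [a4] at b4
  set p := hxh.eigenvalues
  have hp : ∀ k, 0 < p k := hx.eigenvalues_pos
  set Ft := (hxh.eigenvectorUnitary : Matrix m m ℂ)ᴴ * F * hxh.eigenvectorUnitary
  set bt := (hxh.eigenvectorUnitary : Matrix m m ℂ)ᴴ * b * hxh.eigenvectorUnitary with hbt
  have hbs : ∀ k l, ‖bt l k‖ = ‖bt k l‖ := by
    intro k l
    have : bt k l = star (bt l k) := by
      rw [← Matrix.conjTranspose_apply, hbt]
      simp only [Matrix.conjTranspose_mul, Matrix.conjTranspose_conjTranspose, mul_assoc, hb.eq]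
    rw [this, norm_star]
  have hsum : ‖∑ k, (∑ l, (p k : ℂ) * ((Ft k l) * bt l k) - ∑ l, (p l : ℂ) * (Ft k l * bt l k))‖ ≤
      ∑ k, ∑ l, ((β / 4) * (p k * ‖Ft k l‖ ^ 2 + p l * ‖Ft k l‖ ^ 2) + (1 / (2 * β)) *
        ((Real.log (p k) - Real.log (p l)) * (p k - p l) * ‖bt k l‖ ^ 2)) := by
    refine (norm_sum_le _ _).trans (Finset.sum_le_sum fun k _ => ?_)
    rw [← Finset.sum_sub_distrib]
    refine (norm_sum_le _ _).trans (Finset.sum_le_sum fun l _ => ?_)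
    rw [← sub_mul, norm_mul, norm_mul, hbs, ← Complex.ofReal_sub, Complex.norm_real,
      Real.norm_eq_abs]
    have hlog := sub_sq_le_mul_log_sub_log (hp k) (hp l)
    set D := (p k - p l) * (Real.log (p k) - Real.log (p l))
    set u := ‖Ft k l‖
    set v := ‖bt k l‖
    have hpp : 0 < (p k + p l) / 2 := by linarith [hp k, hp l]
    -- weighted arithmetic-geometric mean inequality, with the mean of `p k` and `p l` as weight
    have key : |p k - p l| * (u * v) ≤ β / 2 * ((p k + p l) / 2) * u ^ 2
        + 1 / (2 * β) * ((p k - p l) ^ 2 / ((p k + p l) / 2)) * v ^ 2 := by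
      set P := (p k + p l) / 2
      rw [← sq_abs (p k - p l)]
      set r := |p k - p l|
      have : 0 ≤ (β * P * u - r * v) ^ 2 / (2 * β * P) := by positivity
      have e : (β * P * u - r * v) ^ 2 / (2 * β * P) =
          β / 2 * P * u ^ 2 + 1 / (2 * β) * (r ^ 2 / P) * v ^ 2 - r * (u * v) := by
        field_simp
        ring
      linarith
    have h3 : (p k - p l) ^ 2 / ((p k + p l) / 2) ≤ D := by
      rw [div_le_iff₀ hpp]
      linarith
    have h4 := mul_le_mul_of_nonneg_right
      (mul_le_mul_of_nonneg_left h3 (by positivity : 0 ≤ 1 / (2 * β))) (sq_nonneg v)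
    calc _ ≤ _ := key
      _ ≤ β / 2 * ((p k + p l) / 2) * u ^ 2 + 1 / (2 * β) * D * v ^ 2 := by linarith
      _ = _ := by simp only [D]; ring
  refine hsum.trans ?_
  simp only [Finset.sum_add_distrib, ← Finset.mul_sum]
  have := mul_le_mul_of_nonneg_left (add_le_add b3 b4) (by positivity : 0 ≤ β / 4)
  have e9 : (1 / β) * (-(1 / 2) * ∑ k, ∑ l, (Real.log (p k) - Real.log (p l)) * (p k - p l) *
      ‖bt k l‖ ^ 2) = -(1 / (2 * β) * ∑ k, ∑ l, (Real.log (p k) - Real.log (p l)) * (p k - p l) *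
      ‖bt k l‖ ^ 2) := by
    field_simp
  rw [e9]
  simp only [← Finset.mul_sum] at this
  linarith

end

noncomputable section
variable {m : Type*} [Fintype m] [DecidableEq m]
open Filter Topology

/-! ### Trace functions along a path -/

theorem trace_cfc_eq_sum {A : Matrix m m ℂ} (hA : A.IsHermitian) (f : ℝ → ℝ) :
    (cfc f A).trace.re = ∑ k, f (hA.eigenvalues k) := by
  rw [hA.cfc_eq]
  simp only [Matrix.IsHermitian.cfc, Unitary.conjStarAlgAut_apply]
  rw [Matrix.trace_mul_comm, ← mul_assoc, Unitary.coe_star_mul_self, one_mul,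
    Matrix.trace_diagonal, Complex.re_sum]
  rfl

/-- The trace as a continuous linear functional. -/
def traceCLM (m : Type*) [Fintype m] [DecidableEq m] : Matrix m m ℂ →L[ℂ] ℂ :=
  LinearMap.toContinuousLinearMap (Matrix.traceLinearMap m ℂ ℂ)

theorem traceCLM_apply (x : Matrix m m ℂ) : traceCLM m x = x.trace := rfl

theorem hasDerivWithinAt_trace_mul {X : ℝ → Matrix m m ℂ} {X' : Matrix m m ℂ} {S : Set ℝ} {t : ℝ}
    (hX : HasDerivWithinAt X X' S t) (G : Matrix m m ℂ) :
    HasDerivWithinAt (fun s => (X s * G).trace) (X' * G).trace S t := by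
  have h1 := hX.mul_const G
  exact ((traceCLM m).restrictScalars ℝ).hasFDerivAt.comp_hasDerivWithinAt t h1

/-- The derivative of `tr h(X)` along a path is `tr (X' h'(X))`. The hypothesis `hg` says that `h`
is convex with derivative `g`; the two tangent line inequalities at the two ends of a time step
squeeze the increment of `tr h(X)`. -/
theorem hasDerivWithinAt_trace_cfc {X : ℝ → Matrix m m ℂ} {X' : Matrix m m ℂ} {S K : Set ℝ} {t : ℝ}
    (ht : t ∈ S) (hX : HasDerivWithinAt X X' S t) (hherm : ∀ s ∈ S, (X s).IsHermitian)
    (hK : IsCompact K) (hspec : ∀ᶠ s in 𝓝[S] t, spectrum ℝ (X s) ⊆ K) {h g : ℝ → ℝ}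
    (hgc : ContinuousOn g K) (hg : ∀ x ∈ K, ∀ y ∈ K, (x - y) * g y ≤ h x - h y) :
    HasDerivWithinAt (fun s => (cfc h (X s)).trace.re) (X' * cfc g (X t)).trace.re S t := by
  have hlin : HasDerivWithinAt (fun s => (X s * cfc g (X t)).trace.re)
      (X' * cfc g (X t)).trace.re S t :=
    Complex.reCLM.hasFDerivAt.comp_hasDerivWithinAt t (hasDerivWithinAt_trace_mul hX _)
  have hcont : ContinuousWithinAt (fun s => cfc g (X s)) S t :=
    ContinuousWithinAt.cfc hK g ht hX.continuousWithinAt hspec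
      (eventually_of_mem self_mem_nhdsWithin fun s hs => hherm s hs) hgc
  have hrem : HasDerivWithinAt (fun s => (cfc h (X s)).trace.re -
      (X s * cfc g (X t)).trace.re) 0 S t := by
    rw [hasDerivWithinAt_iff_isLittleO]
    have h1 : (fun s => X s - X t) =O[𝓝[S] t] fun s => s - t := hX.differentiableWithinAt.isBigO_sub
    have h2 : (fun s => cfc g (X s) - cfc g (X t)) =o[𝓝[S] t] fun _ => (1 : ℝ) := by
      rw [Asymptotics.isLittleO_one_iff, ← sub_self (cfc g (X t))]
      exact hcont.tendsto.sub tendsto_const_nhds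
    have h3 := h1.mul_isLittleO h2
    have h4 : (fun s => (X s - X t) * (cfc g (X s) - cfc g (X t))) =o[𝓝[S] t] fun s => s - t := by
      simpa using h3
    have h5 := ((traceCLM m).isBigO_comp
      (fun s => (X s - X t) * (cfc g (X s) - cfc g (X t))) (𝓝[S] t)).trans_isLittleO h4
    refine Asymptotics.IsBigO.trans_isLittleO (Asymptotics.IsBigO.of_bound 1 ?_) h5
    filter_upwards [hspec, self_mem_nhdsWithin] with s hs hsS
    have hst : spectrum ℝ (X t) ⊆ K := hspec.self_of_nhdsWithin ht
    have k1 := klein_inequality (hherm s hsS) (hherm t ht) hs hst hg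
    have k2 := klein_inequality (hherm t ht) (hherm s hsS) hst hs hg
    rw [smul_zero, sub_zero, one_mul, Real.norm_eq_abs, traceCLM_apply]
    refine le_trans ?_ (Complex.abs_re_le_norm _)
    simp only [mul_sub, sub_mul, Matrix.trace_sub, Complex.sub_re] at k1 k2 ⊢
    rw [abs_of_nonneg (by linarith)]
    refine le_trans ?_ (le_abs_self _)
    linarith
  have := hrem.add hlin
  rw [zero_add] at this
  exact this.congr_of_mem (fun s _ => (sub_add_cancel _ _).symm) ht

theorem spectrum_subset_Icc_of_norm_mul_le {A : Matrix m m ℂ} {C : ℝ}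
    (h : ‖A‖ * ‖(1 : Matrix m m ℂ)‖ ≤ C) :
    spectrum ℝ A ⊆ Set.Icc (-C) C := by
  intro y hy
  have := spectrum.norm_le_norm_mul_of_mem hy
  exact abs_le.1 (this.trans h)

/-! ### Evolution under the generator -/

/-- The generator `x ↦ ∑ j, (b j x b j - (b j² x + x b j²) / 2)`. -/
def generator {ι : Type*} [Fintype ι] (b : ι → Matrix m m ℂ) :
    Matrix m m ℂ →ₗ[ℂ] Matrix m m ℂ where
  toFun x := ∑ j, dissipator (b j) x
  map_add' x y := by
    rw [← Finset.sum_add_distrib]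
    refine Finset.sum_congr rfl fun j _ => ?_
    simp only [dissipator, mul_add, add_mul, smul_add]
    abel
  map_smul' c x := by
    simp only [RingHom.id_apply, Finset.smul_sum]
    refine Finset.sum_congr rfl fun j _ => ?_
    simp only [dissipator, mul_smul_comm, smul_mul_assoc, smul_sub, smul_add,
      smul_comm c (1 / 2 : ℂ)]

variable {ι : Type*} [Fintype ι] {b : ι → Matrix m m ℂ}

theorem generator_apply (x : Matrix m m ℂ) : generator b x = ∑ j, dissipator (b j) x := rfl

theorem re_trace_generator_mul_cfc_nonpos (hb : ∀ j, (b j).IsHermitian) {x : Matrix m m ℂ}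
    (hx : x.IsHermitian) {g : ℝ → ℝ} (hg : Monotone g) :
    (generator b x * cfc g x).trace.re ≤ 0 := by
  rw [Matrix.trace_mul_comm, generator_apply, Finset.mul_sum, Matrix.trace_sum, Complex.re_sum]
  refine Finset.sum_nonpos fun j _ => ?_
  rw [re_trace_cfc_mul_dissipator hx (hb j)]
  refine mul_nonpos_of_nonpos_of_nonneg (by norm_num)
    (Finset.sum_nonneg fun k _ => Finset.sum_nonneg fun l _ => mul_nonneg ?_ (sq_nonneg _))
  rcases le_total (hx.eigenvalues k) (hx.eigenvalues l) with h | h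
  · exact mul_nonneg_of_nonpos_of_nonpos (sub_nonpos.2 (hg h)) (sub_nonpos.2 h)
  · exact mul_nonneg (sub_nonneg.2 (hg h)) (sub_nonneg.2 h)

/-- Lower bounds on the spectrum are preserved by the semigroup: the trace of the convex function
`(min (x - c) 0) ^ 2` does not increase. -/
theorem spectrum_subset_Ici_of_hasDerivAt (hb : ∀ j, (b j).IsHermitian) {X : ℝ → Matrix m m ℂ}
    (hX : ∀ t, HasDerivAt X (generator b (X t)) t) (hherm : ∀ t, (X t).IsHermitian) {c : ℝ}
    (h0 : spectrum ℝ (X 0) ⊆ Set.Ici c) {t : ℝ} (ht : 0 ≤ t) : spectrum ℝ (X t) ⊆ Set.Ici c := by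
  set h : ℝ → ℝ := fun y => (min (y - c) 0) ^ 2 with hh
  set g : ℝ → ℝ := fun y => 2 * min (y - c) 0 with hgdef
  have hgm : Monotone g := fun x y hxy =>
    mul_le_mul_of_nonneg_left (min_le_min_right 0 (sub_le_sub_right hxy c)) (by norm_num)
  have hder : ∀ s, HasDerivAt (fun s => (cfc h (X s)).trace.re)
      (generator b (X s) * cfc g (X s)).trace.re s := by
    intro s
    rw [← hasDerivWithinAt_univ]
    refine hasDerivWithinAt_trace_cfc (Set.mem_univ s) (hX s).hasDerivWithinAt
      (fun r _ => hherm r) (K := Set.Icc (-(‖X s‖ * ‖(1 : Matrix m m ℂ)‖ + 1))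
        (‖X s‖ * ‖(1 : Matrix m m ℂ)‖ + 1)) isCompact_Icc ?_ ?_ ?_
    · rw [nhdsWithin_univ]
      have hc : ContinuousAt (fun r => ‖X r‖ * ‖(1 : Matrix m m ℂ)‖) s :=
        (hX s).continuousAt.norm.mul continuousAt_const
      filter_upwards [hc.eventually (gt_mem_nhds (lt_add_one _))] with r hr
      exact spectrum_subset_Icc_of_norm_mul_le hr.le
    · exact (by fun_prop : Continuous g).continuousOn
    · intro x _ y _
      simp only [hh, hgdef]
      rcases le_total (x - c) 0 with h1 | h1 <;> rcases le_total (y - c) 0 with h2 | h2 <;>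
        simp only [min_eq_left, min_eq_right, h1, h2] <;> nlinarith [sq_nonneg (x - y)]
  have hanti : Antitone fun s => (cfc h (X s)).trace.re := by
    refine antitone_of_deriv_nonpos (fun s => (hder s).differentiableAt) fun s => ?_
    rw [(hder s).deriv]
    exact re_trace_generator_mul_cfc_nonpos hb (hherm s) hgm
  have hle := hanti ht
  beta_reduce at hle
  rw [trace_cfc_eq_sum (hherm t), trace_cfc_eq_sum (hherm 0)] at hle
  have hz : ∑ k, h ((hherm 0).eigenvalues k) = 0 := by
    refine Finset.sum_eq_zero fun k _ => ?_
    have h1 : c ≤ (hherm 0).eigenvalues k := h0 ((hherm 0).eigenvalues_mem_spectrum_real k)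
    simp [hh, h1]
  rw [hz] at hle
  have hall := (Finset.sum_eq_zero_iff_of_nonneg fun k _ => sq_nonneg _).1
    (le_antisymm hle (Finset.sum_nonneg fun k _ => sq_nonneg _))
  rw [(hherm t).spectrum_real_eq_range_eigenvalues]
  rintro _ ⟨k, rfl⟩
  have h2 := hall k (Finset.mem_univ k)
  have h3 := pow_eq_zero_iff (two_ne_zero) |>.1 h2
  have h4 := min_eq_right_iff.1 h3
  simpa using h4

/-- The function `x ↦ x log x`, whose trace is the negative entropy. -/
def entropyFun (x : ℝ) : ℝ := x * Real.log x

/-- Convexity of `x log x`. -/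
theorem entropyFun_tangent {x y : ℝ} (hx : 0 ≤ x) (hy : 0 < y) :
    (x - y) * (Real.log y + 1) ≤ entropyFun x - entropyFun y := by
  unfold entropyFun
  rcases hx.eq_or_lt with rfl | hx
  · simp only [zero_mul, zero_sub]
    linarith
  have h1 := Real.log_le_sub_one_of_pos (div_pos hy hx)
  rw [Real.log_div hy.ne' hx.ne'] at h1
  have h2 := mul_le_mul_of_nonneg_left h1 hx.le
  have h3 : x * (y / x - 1) = y - x := by field_simp
  linarith

theorem trace_generator (x : Matrix m m ℂ) : (generator b x).trace = 0 := by
  rw [generator_apply, Matrix.trace_sum]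
  refine Finset.sum_eq_zero fun j _ => ?_
  have h1 : (b j * x * b j).trace = (b j ^ 2 * x).trace := by
    rw [Matrix.trace_mul_comm, ← mul_assoc, pow_two]
  have h2 : (x * b j ^ 2).trace = (b j ^ 2 * x).trace := Matrix.trace_mul_comm _ _
  rw [dissipator, Matrix.trace_sub, Matrix.trace_smul, Matrix.trace_add, h1, h2, smul_eq_mul]
  ring

/-- Along the semigroup the negative entropy has derivative `tr (log X · L X)`. -/
theorem hasDerivWithinAt_trace_entropyFun (hb : ∀ j, (b j).IsHermitian) {X : ℝ → Matrix m m ℂ}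
    (hX : ∀ t, HasDerivAt X (generator b (X t)) t) (hherm : ∀ t, (X t).IsHermitian) {c : ℝ}
    (hc : 0 < c) (h0 : spectrum ℝ (X 0) ⊆ Set.Ici c) {t : ℝ} (ht : 0 ≤ t) :
    HasDerivWithinAt (fun s => (cfc entropyFun (X s)).trace.re)
      (cfc Real.log (X t) * generator b (X t)).trace.re (Set.Ici 0) t := by
  have hlow : ∀ s, 0 ≤ s → spectrum ℝ (X s) ⊆ Set.Ici c := fun s hs =>
    spectrum_subset_Ici_of_hasDerivAt hb hX hherm h0 hs
  have hlogc : ContinuousOn Real.log (Set.Ici c) :=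
    Real.continuousOn_log.mono fun y hy => (hc.trans_le hy).ne'
  have key := hasDerivWithinAt_trace_cfc (S := Set.Ici 0) ht (hX t).hasDerivWithinAt
      (fun r _ => hherm r) (K := Set.Icc c (‖X t‖ * ‖(1 : Matrix m m ℂ)‖ + 1))
      (h := entropyFun) (g := fun y => Real.log y + 1) isCompact_Icc ?_ ?_ ?_
  · have h1 : cfc (fun y => Real.log y + 1) (X t) = cfc Real.log (X t) + 1 := by
      have := cfc_add_const (1 : ℝ) Real.log (X t) (hlogc.mono (hlow t ht)) (hherm t)
      rw [map_one] at this
      exact this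
    rw [h1, mul_add, mul_one, Matrix.trace_add, trace_generator, add_zero,
      Matrix.trace_mul_comm] at key
    exact key
  · have hcn : ContinuousAt (fun r => ‖X r‖ * ‖(1 : Matrix m m ℂ)‖) t :=
      (hX t).continuousAt.norm.mul continuousAt_const
    filter_upwards [nhdsWithin_le_nhds (hcn.eventually (gt_mem_nhds (lt_add_one _))),
      self_mem_nhdsWithin] with r hr hr0 y hy
    exact ⟨hlow r hr0 hy, (spectrum_subset_Icc_of_norm_mul_le hr.le hy).2⟩
  · exact (hlogc.mono Set.Icc_subset_Ici_self).add continuousOn_const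
  · exact fun x hx y hy => entropyFun_tangent (hc.le.trans hx.1) (hc.trans_le hy.1)

/-! ### From entropy decay to a transport bound -/

/-- A scalar form of the transport argument. The speed of `φ` is estimated through the arithmetic
form of the bound by the square root of the dissipation `-D'`, with the time dependent weight
`β = c exp (-lam t / 2)`; this weight makes both terms integrable. -/
theorem norm_sub_le_of_exponential_decay {D D' : ℝ → ℝ} {φ φ' : ℝ → ℂ} {lam N c : ℝ}
    (hlam : 0 < lam) (hN : 0 ≤ N) (hc : 0 < c)
    (hD : ∀ t, 0 ≤ t → HasDerivWithinAt D (D' t) (Set.Ici 0) t) (hD0 : ∀ t, 0 ≤ t → 0 ≤ D t)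
    (hdecay : ∀ t, 0 ≤ t → D t ≤ Real.exp (-lam * t) * D 0)
    (hφ : ∀ t, HasDerivAt φ (φ' t) t)
    (hbound : ∀ t, 0 ≤ t → ∀ β, 0 < β → ‖φ' t‖ ≤ N * β / 4 - D' t / (2 * β)) {T : ℝ}
    (hT : 0 ≤ T) : ‖φ T - φ 0‖ ≤ N * c / (2 * lam) + D 0 / c := by
  set μ := lam / 2 with hμ
  have hμ0 : 0 < μ := by positivity
  -- a primitive of the bound on `‖φ'‖` for the weight `c exp (-μ t)`, increased by using the decay
  -- of `D` in the term that comes from differentiating the weight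
  set B : ℝ → ℝ := fun t => (D 0 / c + N * c / (2 * lam)) - D t * (Real.exp (μ * t) / (2 * c))
    - (D 0 / (2 * c) + N * c / (2 * lam)) * Real.exp (-μ * t) with hB
  have hBd : ∀ t, 0 ≤ t → HasDerivWithinAt B
      (-(D' t * (Real.exp (μ * t) / (2 * c)) + D t * (Real.exp (μ * t) * μ / (2 * c)))
        - (D 0 / (2 * c) + N * c / (2 * lam)) * (Real.exp (-μ * t) * -μ)) (Set.Ici 0) t := by
    intro t ht
    have e1 : HasDerivAt (fun t => Real.exp (μ * t) / (2 * c)) (Real.exp (μ * t) * μ / (2 * c)) t :=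
      (by simpa using ((hasDerivAt_id t).const_mul μ).exp : HasDerivAt
        (fun t => Real.exp (μ * t)) (Real.exp (μ * t) * μ) t).div_const _
    have e2 : HasDerivAt (fun t => Real.exp (-μ * t)) (Real.exp (-μ * t) * -μ) t := by
      simpa using ((hasDerivAt_id t).const_mul (-μ)).exp
    exact (((hD t ht).mul e1.hasDerivWithinAt).const_sub _).sub
      (e2.const_mul _).hasDerivWithinAt
  have hfin := image_norm_le_of_norm_deriv_right_le_deriv_boundary' (f := fun t => φ t - φ 0)
    (f' := φ') (a := 0) (b := T) (B := B)
    (fun t _ => ((hφ t).sub_const (φ 0)).continuousAt.continuousWithinAt)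
    (fun t _ => ((hφ t).sub_const (φ 0)).hasDerivWithinAt) ?_
    (fun t ht => (hBd t ht.1).continuousWithinAt.mono Set.Icc_subset_Ici_self)
    (fun t ht => (hBd t ht.1).mono (Set.Ici_subset_Ici.2 ht.1)) ?_ (Set.right_mem_Icc.2 hT)
  · refine hfin.trans ?_
    have h1 := mul_nonneg (hD0 T hT) (by positivity : 0 ≤ Real.exp (μ * T) / (2 * c))
    have h2 : 0 ≤ (D 0 / (2 * c) + N * c / (2 * lam)) * Real.exp (-μ * T) := by
      have := hD0 0 le_rfl
      positivity
    simp only [hB]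
    linarith
  · simp only [hB, sub_self, norm_zero, mul_zero, Real.exp_zero]
    apply le_of_eq
    field_simp
    ring
  · intro t ht
    have hb1 := hbound t ht.1 (c * Real.exp (-μ * t)) (by positivity)
    have hexp : Real.exp (-μ * t) * Real.exp (μ * t) = 1 := by
      rw [← Real.exp_add]
      simp
    have h3 : D t * Real.exp (μ * t) ≤ D 0 * Real.exp (-μ * t) := by
      have := mul_le_mul_of_nonneg_right (hdecay t ht.1) (Real.exp_pos (μ * t)).le
      have e : Real.exp (-lam * t) = Real.exp (-μ * t) * Real.exp (-μ * t) := by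
        rw [← Real.exp_add, hμ]
        ring_nf
      rw [e] at this
      calc _ ≤ _ := this
        _ = D 0 * Real.exp (-μ * t) * (Real.exp (-μ * t) * Real.exp (μ * t)) := by ring
        _ = _ := by rw [hexp, mul_one]
    have h4 : D' t / (2 * (c * Real.exp (-μ * t))) = D' t * (Real.exp (μ * t) / (2 * c)) := by
      rw [neg_mul, Real.exp_neg]
      field_simp
    rw [h4] at hb1
    refine hb1.trans ?_
    have h5 := mul_le_mul_of_nonneg_left h3 (by positivity : 0 ≤ μ / (2 * c))
    have h6 : N * c / (2 * lam) * μ = N * c / 4 := by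
      rw [hμ]
      field_simp
      ring
    have h7 : (D 0 / (2 * c) + N * c / (2 * lam)) * (Real.exp (-μ * t) * -μ) =
      -(μ / (2 * c) * (D 0 * Real.exp (-μ * t)) + N * c / (2 * lam) * μ * Real.exp (-μ * t)) := by
      ring
    have h8 : D t * (Real.exp (μ * t) * μ / (2 * c)) = μ / (2 * c) * (D t * Real.exp (μ * t)) := by
      ring
    rw [h7, h6, h8]
    linarith

/-- Optimising `N c / (2 lam) + D / c` over `c > 0`, through a discriminant so that `N = 0` and
`D = 0` need no separate treatment. -/
theorem sq_mul_le_of_forall_le {w N D lam : ℝ} (hw : 0 ≤ w) (hN : 0 ≤ N) (hD : 0 ≤ D)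
    (hlam : 0 < lam) (h : ∀ c, 0 < c → w ≤ N * c / (2 * lam) + D / c) :
    w ^ 2 * lam ≤ 2 * N * D := by
  have h1 : ∀ c, 0 < c → w * c ≤ N / (2 * lam) * (c * c) + D := by
    intro c hc
    have := mul_le_mul_of_nonneg_right (h c hc) hc.le
    have e : (N * c / (2 * lam) + D / c) * c = N / (2 * lam) * (c * c) + D := by
      field_simp
    linarith
  have h2 : ∀ c : ℝ, 0 ≤ N / (2 * lam) * (c * c) + (-w) * c + D := by
    intro c
    rcases lt_or_ge 0 c with hc | hc
    · linarith [h1 c hc]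
    · have : 0 ≤ N / (2 * lam) * (c * c) := mul_nonneg (by positivity) (mul_self_nonneg c)
      nlinarith
  have h3 := discrim_le_zero h2
  unfold discrim at h3
  have h4 : w ^ 2 ≤ 2 * N * D / lam := by
    have : 4 * (N / (2 * lam)) * D = 2 * N * D / lam := by
      field_simp
      ring
    linarith
  rwa [le_div_iff₀ hlam] at h4

end

noncomputable section
variable {m : Type*} [Fintype m]
open Filter Topology

/-! ### The conditional expectation onto a commutant -/

variable {ι : Type*} {b : ι → Matrix m m ℂ} {P : Matrix m m ℂ →ₗ[ℂ] Matrix m m ℂ}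

/-- `P` is the trace-preserving conditional expectation onto the commutant of the family `b`. -/
structure IsCommutantExpectation (b : ι → Matrix m m ℂ) (P : Matrix m m ℂ →ₗ[ℂ] Matrix m m ℂ) :
    Prop where
  commute : ∀ x j, Commute (b j) (P x)
  map_eq : ∀ x, (∀ j, Commute (b j) x) → P x = x
  trace_mul : ∀ x y, (∀ j, Commute (b j) y) → (y * P x).trace = (y * x).trace

theorem commute_conjTranspose {a y : Matrix m m ℂ} (ha : a.IsHermitian) (h : Commute a y) :
    Commute a yᴴ := by
  have := congrArg Matrix.conjTranspose h.eq
  rw [Matrix.conjTranspose_mul, Matrix.conjTranspose_mul, ha.eq] at this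
  exact this.symm

namespace IsCommutantExpectation

/-- `P x` is the only element of the commutant with the pairings of `x`. -/
theorem eq_of_trace_mul (hP : IsCommutantExpectation b P) (hb : ∀ j, (b j).IsHermitian)
    {x z : Matrix m m ℂ} (hz : ∀ j, Commute (b j) z)
    (h : ∀ y, (∀ j, Commute (b j) y) → (y * z).trace = (y * x).trace) : P x = z := by
  rw [← sub_eq_zero, ← Matrix.trace_conjTranspose_mul_self_eq_zero_iff]
  have hc : ∀ j, Commute (b j) (P x - z)ᴴ := fun j =>
    commute_conjTranspose (hb j) ((hP.commute x j).sub_right (hz j))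
  rw [mul_sub, Matrix.trace_sub, hP.trace_mul _ _ hc, h _ hc, sub_self]

theorem map_conjTranspose (hP : IsCommutantExpectation b P) (hb : ∀ j, (b j).IsHermitian)
    (x : Matrix m m ℂ) : P xᴴ = (P x)ᴴ := by
  refine hP.eq_of_trace_mul hb (fun j => commute_conjTranspose (hb j) (hP.commute x j))
    fun y hy => ?_
  have h := hP.trace_mul x yᴴ fun j => commute_conjTranspose (hb j) (hy j)
  have h2 := congrArg star h
  rw [← Matrix.trace_conjTranspose, ← Matrix.trace_conjTranspose, Matrix.conjTranspose_mul,
    Matrix.conjTranspose_mul, Matrix.conjTranspose_conjTranspose] at h2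
  rw [Matrix.trace_mul_comm y, Matrix.trace_mul_comm y, h2]

theorem isHermitian (hP : IsCommutantExpectation b P) (hb : ∀ j, (b j).IsHermitian)
    {x : Matrix m m ℂ} (hx : x.IsHermitian) : (P x).IsHermitian := by
  rw [Matrix.IsHermitian, ← hP.map_conjTranspose hb, hx.eq]

end IsCommutantExpectation

variable [DecidableEq m]

theorem commute_cfc {a x : Matrix m m ℂ} (h : Commute a x) (f : ℝ → ℝ) :
    Commute a (cfc f x) := (Commute.cfc_real h.symm f).symm

namespace IsCommutantExpectation

theorem map_one (hP : IsCommutantExpectation b P) : P 1 = 1 :=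
  hP.map_eq 1 fun _ => Commute.one_right _

open scoped MatrixOrder in
/-- Positivity: the negative part of `P x` lies in the commutant, so it may be used as a test
matrix. -/
theorem posSemidef (hP : IsCommutantExpectation b P) (hb : ∀ j, (b j).IsHermitian)
    {x : Matrix m m ℂ} (hx : x.PosSemidef) :
    (P x).PosSemidef := by
  have hz := hP.isHermitian hb hx.isHermitian
  have hz' : IsSelfAdjoint (P x) := hz
  set f : ℝ → ℝ := fun y => max (-y) 0
  have h1 : (cfc f (P x)).PosSemidef :=
    Matrix.nonneg_iff_posSemidef.1 (cfc_nonneg fun y _ => le_max_right _ _)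
  have h2 := trace_mul_nonneg h1 hx
  rw [← hP.trace_mul x _ fun j => commute_cfc (hP.commute x j) f] at h2
  have h3 : cfc f (P x) * P x = cfc (fun y => f y * y) (P x) := by
    rw [cfc_mul f (fun y => y) (P x) (by fun_prop) (by fun_prop), cfc_id' ℝ (P x) hz']
  rw [h3, trace_cfc_eq_sum hz] at h2
  rw [hz.posSemidef_iff_eigenvalues_nonneg]
  intro k
  have hle : ∀ y : ℝ, f y * y ≤ 0 := fun y => by
    rcases le_total y 0 with h | h
    · exact mul_nonpos_of_nonneg_of_nonpos (le_max_right _ _) h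
    · simp [f, h]
  have h4 := (Finset.sum_eq_zero_iff_of_nonpos fun k _ => hle (hz.eigenvalues k)).1
    (le_antisymm (Finset.sum_nonpos fun k _ => hle (hz.eigenvalues k)) h2) k (Finset.mem_univ k)
  by_contra hneg
  have hneg' : hz.eigenvalues k < 0 := not_le.1 hneg
  rcases mul_eq_zero.1 h4 with h | h
  · simp only [f, max_eq_left (neg_nonneg.2 hneg'.le)] at h
    linarith
  · exact hneg'.ne h

theorem trace_map (hP : IsCommutantExpectation b P) (x : Matrix m m ℂ) :
    (P x).trace = x.trace := by
  simpa using hP.trace_mul x 1 fun _ => Commute.one_right _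

end IsCommutantExpectation

open scoped MatrixOrder in
theorem posSemidef_sub_smul_one {x : Matrix m m ℂ} (hx : x.IsHermitian) {c : ℝ}
    (h : spectrum ℝ x ⊆ Set.Ici c) : (x - (c : ℂ) • 1).PosSemidef := by
  have h1 := (algebraMap_le_iff_le_spectrum (R := ℝ) (r := c) (a := x) hx).2 fun y hy => h hy
  rw [Matrix.le_iff, Algebra.algebraMap_eq_smul_one] at h1
  rwa [← Complex.coe_smul] at h1

theorem exists_spectrum_subset_Ici {x : Matrix m m ℂ} (hx : x.PosDef) :
    ∃ c : ℝ, 0 < c ∧ spectrum ℝ x ⊆ Set.Ici c := by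
  rw [hx.isHermitian.spectrum_real_eq_range_eigenvalues]
  rcases isEmpty_or_nonempty m with h | h
  · exact ⟨1, one_pos, by rintro _ ⟨k, rfl⟩; exact h.elim k⟩
  · obtain ⟨k, hk⟩ := Finite.exists_min hx.isHermitian.eigenvalues
    exact ⟨_, hx.eigenvalues_pos k, by rintro _ ⟨l, rfl⟩; exact hk l⟩

theorem posDef_of_spectrum_subset {x : Matrix m m ℂ} (hx : x.IsHermitian) {c : ℝ} (hc : 0 < c)
    (h : spectrum ℝ x ⊆ Set.Ici c) : x.PosDef :=
  hx.posDef_iff_eigenvalues_pos.2 fun k => hc.trans_le (h (hx.eigenvalues_mem_spectrum_real k))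

theorem posDef_smul_one {k : Type*} [DecidableEq k] {c : ℝ} (hc : 0 < c) :
    ((c : ℂ) • (1 : Matrix k k ℂ)).PosDef :=
  Matrix.PosDef.one.smul (by exact_mod_cast hc : (0 : ℂ) < c)

theorem IsCommutantExpectation.posDef (hP : IsCommutantExpectation b P)
    (hb : ∀ j, (b j).IsHermitian) {x : Matrix m m ℂ} (hx : x.PosDef) : (P x).PosDef := by
  obtain ⟨c, hc, h⟩ := exists_spectrum_subset_Ici hx
  have h1 := hP.posSemidef hb (posSemidef_sub_smul_one hx.isHermitian h)
  rw [map_sub, map_smul, hP.map_one] at h1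
  simpa using Matrix.PosDef.posSemidef_add h1 (posDef_smul_one (k := m) hc)

/-! ### The entropy gap -/

/-- The entropy of `x` relative to its conditional expectation,
`tr (x log x) - tr (P x log (P x))`. -/
def entropyGap (P : Matrix m m ℂ →ₗ[ℂ] Matrix m m ℂ) (x : Matrix m m ℂ) : ℝ :=
  (cfc entropyFun x).trace.re - (cfc entropyFun (P x)).trace.re

theorem mul_cfc_log {x : Matrix m m ℂ} (hx : x.IsHermitian) :
    x * cfc Real.log x = cfc entropyFun x := by
  have hx' : IsSelfAdjoint x := hx
  have hc := continuousOn_spectrum x Real.log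
  unfold entropyFun
  rw [cfc_mul (fun y => y) Real.log x (by fun_prop) hc, cfc_id' ℝ x hx']

/-- Since `log (P x)` is in the commutant, `tr (x log (P x)) = tr (P x log (P x))`. -/
theorem IsCommutantExpectation.re_trace_mul_log_sub_log (hP : IsCommutantExpectation b P)
    (hb : ∀ j, (b j).IsHermitian) {x : Matrix m m ℂ} (hx : x.IsHermitian) :
    (x * (cfc Real.log x - cfc Real.log (P x))).trace.re = entropyGap P x := by
  rw [mul_sub, Matrix.trace_sub, Complex.sub_re, mul_cfc_log hx, entropyGap,
    Matrix.trace_mul_comm x (cfc Real.log (P x)),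
    ← hP.trace_mul x _ fun j => commute_cfc (hP.commute x j) _, Matrix.trace_mul_comm,
    mul_cfc_log (hP.isHermitian hb hx)]

theorem IsCommutantExpectation.relEntropy_eq (hP : IsCommutantExpectation b P)
    (hb : ∀ j, (b j).IsHermitian) {x : Matrix m m ℂ} (hx : x.IsHermitian)
    (hker : LinearMap.ker (P x).mulVecLin ≤ LinearMap.ker x.mulVecLin) :
    relEntropy x (P x) = ENNReal.ofReal (entropyGap P x) := by
  rw [relEntropy, if_pos hker, hP.re_trace_mul_log_sub_log hb hx]

theorem ker_mulVecLin_eq_bot_of_posDef {x : Matrix m m ℂ} (hx : x.PosDef) :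
    LinearMap.ker x.mulVecLin = ⊥ := by
  rw [LinearMap.ker_eq_bot, Matrix.coe_mulVecLin]
  exact Matrix.mulVec_injective_iff_isUnit.2 hx.isUnit

theorem IsCommutantExpectation.relEntropy_eq_of_posDef (hP : IsCommutantExpectation b P)
    (hb : ∀ j, (b j).IsHermitian) {x : Matrix m m ℂ} (hx : x.PosDef) :
    relEntropy x (P x) = ENNReal.ofReal (entropyGap P x) := by
  refine hP.relEntropy_eq hb hx.isHermitian ?_
  rw [ker_mulVecLin_eq_bot_of_posDef (hP.posDef hb hx)]
  exact bot_le

/-- Klein's inequality for `x log x`; its linear term pairs `x - P x` with the commutant. -/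
theorem IsCommutantExpectation.entropyGap_nonneg (hP : IsCommutantExpectation b P)
    (hb : ∀ j, (b j).IsHermitian) {x : Matrix m m ℂ} (hx : x.PosDef) : 0 ≤ entropyGap P x := by
  have hPx := hP.posDef hb hx
  have hsub : ∀ {y : Matrix m m ℂ}, y.PosDef → spectrum ℝ y ⊆ Set.Ioi 0 := fun hy => by
    obtain ⟨c, hc, h⟩ := exists_spectrum_subset_Ici hy
    exact h.trans (Set.Ici_subset_Ioi.2 hc)
  have h1 := klein_inequality hx.isHermitian hPx.isHermitian (hsub hx) (hsub hPx)
    (h := entropyFun) (g := fun y => Real.log y + 1)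
    fun u hu v hv => entropyFun_tangent (le_of_lt hu) hv
  refine le_of_eq_of_le ?_ h1
  rw [Matrix.trace_mul_comm, mul_sub, Matrix.trace_sub,
    hP.trace_mul x _ fun j => commute_cfc (hP.commute x j) _, sub_self, Complex.zero_re]

variable [Fintype ι]

/-! ### The generator and the commutant -/

theorem trace_mul_generator (x y : Matrix m m ℂ) :
    (y * generator b x).trace = (generator b y * x).trace := by
  simp only [generator_apply, Finset.mul_sum, Finset.sum_mul, Matrix.trace_sum]
  refine Finset.sum_congr rfl fun j _ => ?_
  simp only [dissipator, mul_sub, sub_mul, mul_smul_comm, smul_mul_assoc, mul_add, add_mul,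
    Matrix.trace_sub, Matrix.trace_add, Matrix.trace_smul]
  rw [add_comm (y * (b j ^ 2 * x)).trace, ← mul_assoc y x, Matrix.trace_mul_comm (y * x),
    ← mul_assoc y (b j * x), Matrix.trace_mul_comm _ (b j)]
  simp only [mul_assoc]

theorem dissipator_eq_commutator (c x : Matrix m m ℂ) :
    dissipator c x = -(1 / 2 : ℂ) • (c * (c * x - x * c) - (c * x - x * c) * c) := by
  have h : c * (c * x - x * c) - (c * x - x * c) * c
      = (c ^ 2 * x + x * c ^ 2) - (2 : ℂ) • (c * x * c) := by
    rw [two_smul]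
    noncomm_ring
  rw [h, dissipator, smul_sub, smul_smul]
  norm_num
  abel

theorem generator_eq_zero_of_commute {x : Matrix m m ℂ} (hx : ∀ j, Commute (b j) x) :
    generator b x = 0 := by
  rw [generator_apply]
  refine Finset.sum_eq_zero fun j _ => ?_
  rw [dissipator_eq_commutator, (hx j).eq]
  simp

/-- `tr (x* L x)` is `-1 / 2` times the sum of the squared Hilbert–Schmidt norms of the commutators
`[b j, x]`. -/
theorem commute_of_generator_eq_zero (hb : ∀ j, (b j).IsHermitian) {x : Matrix m m ℂ}
    (hx : generator b x = 0) (j : ι) : Commute (b j) x := by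
  have h1 : ∀ j, (xᴴ * dissipator (b j) x).trace =
      -(1 / 2 : ℂ) * ((b j * x - x * b j)ᴴ * (b j * x - x * b j)).trace := by
    intro j
    have hbj := (hb j).eq
    rw [dissipator_eq_commutator, mul_smul_comm, Matrix.trace_smul, smul_eq_mul,
      Matrix.conjTranspose_sub, Matrix.conjTranspose_mul, Matrix.conjTranspose_mul, hbj]
    generalize b j * x - x * b j = z
    congr 1
    rw [mul_sub, sub_mul, Matrix.trace_sub, Matrix.trace_sub, ← mul_assoc xᴴ z,
      Matrix.trace_mul_comm (xᴴ * z), ← mul_assoc xᴴ, mul_assoc (b j)]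
  have h2 : ∑ j, ((b j * x - x * b j)ᴴ * (b j * x - x * b j)).trace = 0 := by
    have h3 : (xᴴ * generator b x).trace = 0 := by rw [hx, mul_zero, Matrix.trace_zero]
    rw [generator_apply, Finset.mul_sum, Matrix.trace_sum] at h3
    simp only [h1, ← Finset.mul_sum] at h3
    exact (mul_eq_zero.1 h3).resolve_left (by norm_num)
  have h4 := (Finset.sum_eq_zero_iff_of_nonneg fun j _ =>
    (Matrix.posSemidef_conjTranspose_mul_self (b j * x - x * b j)).trace_nonneg).1 h2 j
    (Finset.mem_univ j)
  exact sub_eq_zero.1 (Matrix.trace_conjTranspose_mul_self_eq_zero_iff.1 h4)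

theorem IsCommutantExpectation.map_generator (hP : IsCommutantExpectation b P)
    (hb : ∀ j, (b j).IsHermitian) (x : Matrix m m ℂ) : P (generator b x) = 0 := by
  refine hP.eq_of_trace_mul hb (fun j => Commute.zero_right _) fun y hy => ?_
  rw [trace_mul_generator, generator_eq_zero_of_commute hy]
  simp

theorem IsCommutantExpectation.map_eq_map_zero (hP : IsCommutantExpectation b P)
    (hb : ∀ j, (b j).IsHermitian) {X : ℝ → Matrix m m ℂ}
    (hX : ∀ t, HasDerivAt X (generator b (X t)) t) (t : ℝ) : P (X t) = P (X 0) := by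
  have hd : ∀ s, HasDerivAt (fun s => P (X s)) 0 s := fun s => by
    have := ((LinearMap.toContinuousLinearMap P).restrictScalars ℝ).hasFDerivAt.comp_hasDerivAt s
      (hX s)
    rwa [ContinuousLinearMap.coe_restrictScalars', LinearMap.coe_toContinuousLinearMap',
      hP.map_generator hb] at this
  exact is_const_of_deriv_eq_zero (fun s => (hd s).differentiableAt) (fun s => (hd s).deriv) t 0

/-- The generator is onto the kernel of `P`: it maps that kernel into itself, injectively. -/
theorem IsCommutantExpectation.exists_generator_eq (hP : IsCommutantExpectation b P)
    (hb : ∀ j, (b j).IsHermitian) {f : Matrix m m ℂ} (hf : P f = 0) :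
    ∃ g, generator b g = f := by
  let G : LinearMap.ker P →ₗ[ℂ] LinearMap.ker P :=
    (generator b).restrict fun x _ => LinearMap.mem_ker.2 (hP.map_generator hb x)
  have hinj : Function.Injective G := by
    rw [← LinearMap.ker_eq_bot, LinearMap.ker_eq_bot']
    intro x hx
    have h1 : generator b (x : Matrix m m ℂ) = 0 := congrArg Subtype.val hx
    have h2 := hP.map_eq _ (commute_of_generator_eq_zero hb h1)
    have h3 : P (x : Matrix m m ℂ) = 0 := x.2
    exact Subtype.ext (h2.symm.trans h3)
  obtain ⟨g, hg⟩ := LinearMap.injective_iff_surjective.1 hinj ⟨f, hf⟩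
  exact ⟨g, congrArg Subtype.val hg⟩

/-! ### The transport estimate -/

/-- The speed of `tr (f X)` along the semigroup, for `f` with commutators of norm at most one, in
terms of the entropy production. -/
theorem norm_trace_mul_generator_le (hb : ∀ j, (b j).IsHermitian) {f x : Matrix m m ℂ}
    (hf : ∀ j, ‖b j * f - f * b j‖ ≤ 1) (hx : x.PosDef) (htr : x.trace = 1) {β : ℝ} (hβ : 0 < β) :
    ‖(f * generator b x).trace‖ ≤ (Fintype.card ι : ℝ) * β / 4 -
      (cfc Real.log x * generator b x).trace.re / (2 * β) := by
  simp only [generator_apply, Finset.mul_sum, Matrix.trace_sum, Complex.re_sum]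
  have hterm : ∀ j, ‖(f * dissipator (b j) x).trace‖ ≤
      β / 4 - (cfc Real.log x * dissipator (b j) x).trace.re / (2 * β) := by
    intro j
    have h1 := norm_trace_mul_commutator_le hx (hb j) (F := b j * f - f * b j) (hf j) hβ
    have h2 : (f * dissipator (b j) x).trace =
        (1 / 2 : ℂ) * ((b j * f - f * b j) * (b j * x - x * b j)).trace := by
      rw [dissipator_eq_commutator, mul_smul_comm, Matrix.trace_smul, smul_eq_mul]
      generalize b j * x - x * b j = z
      rw [mul_sub, sub_mul, Matrix.trace_sub, Matrix.trace_sub, ← mul_assoc f z,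
        Matrix.trace_mul_comm (f * z), mul_assoc (b j), mul_assoc f]
      ring
    rw [h2, norm_mul]
    have h3 : ‖(1 / 2 : ℂ)‖ = 1 / 2 := by norm_num
    rw [h3]
    rw [htr, Complex.one_re] at h1
    have h4 : 1 / 2 * (β / 2 * 1 - 1 / β * (cfc Real.log x * dissipator (b j) x).trace.re) =
        β / 4 - (cfc Real.log x * dissipator (b j) x).trace.re / (2 * β) := by
      field_simp
      ring
    linarith
  refine (norm_sum_le _ _).trans ((Finset.sum_le_sum fun j _ => hterm j).trans (le_of_eq ?_))
  rw [Finset.sum_sub_distrib, Finset.sum_div, Finset.sum_const, Finset.card_univ, nsmul_eq_mul]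
  ring

/-- Transport estimate: exponential entropy decay along the semigroup bounds the pairing of the
initial state with a mean zero Lipschitz element `f = L g`. The bound for `tr (f X)` between times
`0` and `T` gives one at time `0` because `tr (f X)` is the derivative of the bounded function
`tr (g X)`. -/
theorem norm_trace_mul_sq_mul_le (hP : IsCommutantExpectation b P) (hb : ∀ j, (b j).IsHermitian)
    {X : ℝ → Matrix m m ℂ} (hX : ∀ t, HasDerivAt X (generator b (X t)) t)
    (hherm : ∀ t, (X t).IsHermitian) (h0 : (X 0).PosDef) (htr0 : (X 0).trace = 1) {lam : ℝ}
    (hlam : 0 < lam)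
    (hdecay : ∀ t, 0 ≤ t → (∀ s, 0 ≤ s → (X s).PosDef) →
      entropyGap P (X t) ≤ Real.exp (-lam * t) * entropyGap P (X 0))
    {f : Matrix m m ℂ} (hPf : P f = 0) (hf : ∀ j, ‖b j * f - f * b j‖ ≤ 1) :
    ‖(f * X 0).trace‖ ^ 2 * lam ≤ 2 * (Fintype.card ι : ℝ) * entropyGap P (X 0) := by
  obtain ⟨c₀, hc₀, hspec⟩ := exists_spectrum_subset_Ici h0
  have hpos : ∀ t, 0 ≤ t → (X t).PosDef := fun t ht => posDef_of_spectrum_subset (hherm t) hc₀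
    (spectrum_subset_Ici_of_hasDerivAt hb hX hherm hspec ht)
  have hPX : ∀ t, P (X t) = P (X 0) := hP.map_eq_map_zero hb hX
  have htr : ∀ t, (X t).trace = 1 := fun t => by
    rw [← hP.trace_map, hPX, hP.trace_map, htr0]
  have hD : ∀ t, 0 ≤ t → HasDerivWithinAt (fun s => entropyGap P (X s))
      (cfc Real.log (X t) * generator b (X t)).trace.re (Set.Ici 0) t := by
    intro t ht
    simp only [entropyGap, hPX]
    exact (hasDerivWithinAt_trace_entropyFun hb hX hherm hc₀ hspec ht).sub_const _
  have hpair : ∀ (y : Matrix m m ℂ) t, HasDerivAt (fun s => (y * X s).trace)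
      (y * generator b (X t)).trace t := fun y t =>
    ((traceCLM m).restrictScalars ℝ).hasFDerivAt.comp_hasDerivAt t ((hX t).const_mul y)
  obtain ⟨g, rfl⟩ := hP.exists_generator_eq hb hPf
  refine sq_mul_le_of_forall_le (norm_nonneg _) (Nat.cast_nonneg _)
    (hP.entropyGap_nonneg hb h0) hlam fun c hc => ?_
  set κ := (Fintype.card ι : ℝ) * c / (2 * lam) + entropyGap P (X 0) / c
  have hκ : ∀ T, 0 ≤ T → ‖(generator b g * X T).trace - (generator b g * X 0).trace‖ ≤ κ :=
    fun T hT => norm_sub_le_of_exponential_decay (D := fun s => entropyGap P (X s))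
      (φ := fun s => (generator b g * X s).trace) hlam (Nat.cast_nonneg _) hc hD
      (fun t ht => hP.entropyGap_nonneg hb (hpos t ht)) (fun t ht => hdecay t ht hpos)
      (hpair _) (fun t ht β hβ => norm_trace_mul_generator_le hb hf (hpos t ht) (htr t) hβ) hT
  have hbdd : ∀ t, 0 ≤ t → ‖(g * X t).trace‖ ≤ ‖g‖ := fun t ht => by
    have := norm_trace_mul_le (hpos t ht).posSemidef g
    rwa [Matrix.trace_mul_comm, htr, Complex.one_re, mul_one] at this
  -- `tr (g X)` is bounded, yet moves with speed within `κ` of `tr (f X 0)` for all time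
  have hmain : ∀ T, 0 < T → ‖(generator b g * X 0).trace‖ ≤ κ + 2 * ‖g‖ / T := by
    intro T hT
    set w := (generator b g * X 0).trace
    have hψ : ∀ t, HasDerivAt (fun s : ℝ => (g * X s).trace - (s : ℂ) * w)
        ((generator b g * X t).trace - w) t := fun t => by
      have h1 := (hpair g t).sub ((Complex.ofRealCLM.hasDerivAt (x := t)).mul_const w)
      rw [trace_mul_generator, Complex.ofRealCLM_apply, Complex.ofReal_one, one_mul] at h1
      exact h1
    have h2 := norm_image_sub_le_of_norm_deriv_le_segment' (a := 0) (b := T) (C := κ)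
      (fun t _ => (hψ t).hasDerivWithinAt) (fun t ht => hκ t ht.1) T ⟨hT.le, le_rfl⟩
    have h3 : (T : ℂ) * w = ((g * X T).trace - (g * X 0).trace) -
        (((g * X T).trace - (T : ℂ) * w) - ((g * X 0).trace - ((0 : ℝ) : ℂ) * w)) := by
      push_cast
      ring
    have h4 : T * ‖w‖ ≤ 2 * ‖g‖ + κ * T := by
      have h5 := congrArg norm h3
      rw [norm_mul, Complex.norm_real, Real.norm_of_nonneg hT.le] at h5
      rw [h5]
      refine (norm_sub_le _ _).trans (add_le_add ((norm_sub_le _ _).trans ?_) (by simpa using h2))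
      linarith [hbdd T hT.le, hbdd 0 le_rfl]
    have h6 : κ + 2 * ‖g‖ / T = (2 * ‖g‖ + κ * T) / T := by
      field_simp
      ring
    rw [h6, le_div_iff₀ hT]
    linarith
  have hlim : Tendsto (fun T : ℝ => κ + 2 * ‖g‖ / T) atTop (𝓝 (κ + 0)) :=
    tendsto_const_nhds.add (tendsto_const_nhds.div_atTop tendsto_id)
  rw [add_zero] at hlim
  exact ge_of_tendsto hlim ((eventually_gt_atTop 0).mono hmain)

/-! ### Norms from states -/

/-- The rank one matrix of `v` is approximated by faithful states, up to scaling. -/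
theorem norm_star_dotProduct_mulVec_le {f : Matrix m m ℂ} {w : ℝ}
    (h : ∀ ρ : Matrix m m ℂ, ρ.PosDef → ρ.trace = 1 → ‖(f * ρ).trace‖ ≤ w) (v : m → ℂ) :
    ‖star v ⬝ᵥ f *ᵥ v‖ ≤ w * ‖WithLp.toLp 2 v‖ ^ 2 := by
  rcases isEmpty_or_nonempty m with hm | hm
  · simp [Subsingleton.elim v 0]
  set M := Matrix.vecMulVec v (star v)
  have hM : M.PosSemidef := Matrix.posSemidef_vecMulVec_self_star v
  have htrM : M.trace = ((‖WithLp.toLp 2 v‖ ^ 2 : ℝ) : ℂ) := by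
    rw [Matrix.trace_vecMulVec, EuclideanSpace.norm_sq_eq, dotProduct]
    push_cast
    refine Finset.sum_congr rfl fun i _ => ?_
    rw [Pi.star_apply, Complex.star_def, Complex.mul_conj, Complex.normSq_eq_norm_sq]
    norm_cast
  have hfM : (f * M).trace = star v ⬝ᵥ f *ᵥ v := by
    rw [Matrix.mul_vecMulVec, Matrix.trace_vecMulVec, dotProduct_comm]
  set K : ℝ := (Fintype.card m : ℝ)
  have hK : 0 < K := Nat.cast_pos.2 Fintype.card_pos
  have hε : ∀ ε : ℝ, 0 < ε → ‖(f * M).trace‖ ≤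
      w * (‖WithLp.toLp 2 v‖ ^ 2 + ε * K) + ε * ‖f.trace‖ := by
    intro ε hε
    set s : ℝ := ‖WithLp.toLp 2 v‖ ^ 2 + ε * K
    have hs : 0 < s := by positivity
    have htr : (M + (ε : ℂ) • 1).trace = (s : ℂ) := by
      rw [Matrix.trace_add, htrM, Matrix.trace_smul, Matrix.trace_one]
      simp [s, K]
    have hpd : (M + (ε : ℂ) • 1).PosDef := Matrix.PosDef.posSemidef_add hM (posDef_smul_one hε)
    have h1 := h (((s⁻¹ : ℝ) : ℂ) • (M + (ε : ℂ) • 1))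
      (hpd.smul (by exact_mod_cast inv_pos.2 hs)) (by
        rw [Matrix.trace_smul, htr, smul_eq_mul, ← Complex.ofReal_mul, inv_mul_cancel₀ hs.ne',
          Complex.ofReal_one])
    rw [mul_smul_comm, Matrix.trace_smul, norm_smul, Complex.norm_real,
      Real.norm_of_nonneg (inv_pos.2 hs).le, inv_mul_le_iff₀ hs] at h1
    have h2 : (f * M).trace = (f * (M + (ε : ℂ) • 1)).trace - (ε : ℂ) * f.trace := by
      rw [mul_add, mul_smul_comm, mul_one, Matrix.trace_add, Matrix.trace_smul, smul_eq_mul]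
      ring
    rw [h2]
    refine (norm_sub_le _ _).trans ?_
    rw [norm_mul, Complex.norm_real, Real.norm_of_nonneg hε.le]
    linarith
  rw [← hfM]
  have hlim : Tendsto (fun ε : ℝ => w * (‖WithLp.toLp 2 v‖ ^ 2 + ε * K) + ε * ‖f.trace‖)
      (𝓝[>] 0) (𝓝 (w * (‖WithLp.toLp 2 v‖ ^ 2 + 0 * K) + 0 * ‖f.trace‖)) := by
    refine Tendsto.mono_left (Continuous.tendsto ?_ 0) nhdsWithin_le_nhds
    fun_prop
  simp only [zero_mul, add_zero] at hlim
  exact ge_of_tendsto hlim (eventually_of_mem self_mem_nhdsWithin hε)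

/-- A matrix is determined in norm, up to a factor `4`, by its values on faithful states; the
factor comes from the polarization identity. -/
theorem norm_le_four_mul_of_forall_state {f : Matrix m m ℂ} {w : ℝ} (hw : 0 ≤ w)
    (h : ∀ ρ : Matrix m m ℂ, ρ.PosDef → ρ.trace = 1 → ‖(f * ρ).trace‖ ≤ w) : ‖f‖ ≤ 4 * w := by
  set T := Matrix.toEuclideanCLM (n := m) (𝕜 := ℂ) f
  have hT : ∀ z : EuclideanSpace ℂ m, ‖inner ℂ (T z) z‖ ≤ w * ‖z‖ ^ 2 := by
    intro z
    have h1 := norm_star_dotProduct_mulVec_le h z.ofLp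
    rw [← inner_conj_symm, RCLike.norm_conj, EuclideanSpace.inner_eq_star_dotProduct,
      dotProduct_comm]
    exact h1
  rw [Matrix.cstar_norm_def]
  refine ContinuousLinearMap.opNorm_le_bound _ (by positivity) fun y => ?_
  change ‖T y‖ ≤ 4 * w * ‖y‖
  rcases eq_or_ne (T y) 0 with h0 | h0
  · rw [h0, norm_zero]
    positivity
  have hTy : 0 < ‖T y‖ := norm_pos_iff.2 h0
  -- polarize against the multiple of `T y` with the norm of `y`
  set r : ℝ := ‖y‖ / ‖T y‖
  set x : EuclideanSpace ℂ m := (r : ℂ) • T y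
  have hr : 0 ≤ r := by positivity
  have hx : ‖x‖ = ‖y‖ := by
    rw [norm_smul, Complex.norm_real, Real.norm_of_nonneg hr]
    exact div_mul_cancel₀ _ hTy.ne'
  have hpol := inner_map_polarization' (T : EuclideanSpace ℂ m →ₗ[ℂ] EuclideanSpace ℂ m) y x
  have hin : ‖inner ℂ (T y) x‖ = ‖y‖ * ‖T y‖ := by
    rw [inner_smul_right, norm_mul, Complex.norm_real, Real.norm_of_nonneg hr,
      inner_self_eq_norm_sq_to_K, norm_pow, RCLike.norm_ofReal, abs_of_pos hTy]
    simp only [r]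
    field_simp
  have hb : ∀ z : EuclideanSpace ℂ m, ‖z‖ ≤ 2 * ‖y‖ →
      ‖inner ℂ (T z) z‖ ≤ 4 * w * ‖y‖ ^ 2 := fun z hz => by
    refine (hT z).trans ?_
    have := mul_le_mul_of_nonneg_left (pow_le_pow_left₀ (norm_nonneg z) hz 2) hw
    linarith
  have hI : ‖Complex.I • x‖ = ‖y‖ := by rw [norm_smul, Complex.norm_I, one_mul, hx]
  have k1 := hb (y + x) ((norm_add_le _ _).trans (by linarith))
  have k2 := hb (y - x) ((norm_sub_le _ _).trans (by linarith))
  have k3 := hb (y + Complex.I • x) ((norm_add_le _ _).trans (by linarith))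
  have k4 := hb (y - Complex.I • x) ((norm_sub_le _ _).trans (by linarith))
  have hfin : ‖inner ℂ (T y) x‖ ≤ 4 * w * ‖y‖ ^ 2 := by
    simp only [ContinuousLinearMap.coe_coe] at hpol
    rw [hpol, norm_div, show ‖(4 : ℂ)‖ = 4 by norm_num, div_le_iff₀ (by norm_num)]
    refine (norm_add_le _ _).trans ?_
    refine (add_le_add ((norm_sub_le _ _).trans (add_le_add (norm_sub_le _ _) le_rfl)) le_rfl).trans
      ?_
    rw [norm_mul, norm_mul, Complex.norm_I]
    linarith
  rw [hin] at hfin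
  rcases eq_or_lt_of_le (norm_nonneg y) with hy | hy
  · rw [norm_eq_zero.1 hy.symm, map_zero] at h0
    exact absurd rfl h0
  · nlinarith

end

noncomputable section
variable {m : Type*} [Fintype m] [DecidableEq m]
open Filter Topology

/-! ### Relative entropy and the index -/

variable {ι : Type*} {b : ι → Matrix m m ℂ} {P : Matrix m m ℂ →ₗ[ℂ] Matrix m m ℂ}

open scoped MatrixOrder in
/-- For faithful states this is operator monotonicity of the logarithm. -/
theorem IsCommutantExpectation.entropyGap_le_log_of_posDef (hP : IsCommutantExpectation b P)
    (hb : ∀ j, (b j).IsHermitian) {x : Matrix m m ℂ} (hx : x.PosDef) (htr : x.trace = 1) {α : ℝ}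
    (hα : 0 < α) (h : ((α : ℂ) • P x - x).PosSemidef) : entropyGap P x ≤ Real.log α := by
  have hPx := hP.posDef hb hx
  have h1 : x ≤ α • P x := by
    rw [Matrix.le_iff, ← Complex.coe_smul]
    exact h
  have h2 : CFC.log x ≤ CFC.log (α • P x) :=
    CFC.log_le_log h1 (Matrix.isStrictlyPositive_iff_posDef.2 hx)
  rw [CFC.log_smul' (P x) hα (Matrix.isStrictlyPositive_iff_posDef.2 hPx), Matrix.le_iff] at h2
  have h3 := trace_mul_nonneg hx.posSemidef h2
  have h4 := hP.re_trace_mul_log_sub_log hb hx.isHermitian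
  have h5 : x * (algebraMap ℝ (Matrix m m ℂ) (Real.log α) + CFC.log (P x) - CFC.log x) =
      (Real.log α : ℂ) • x - x * (CFC.log x - CFC.log (P x)) := by
    rw [Algebra.algebraMap_eq_smul_one, ← Complex.coe_smul, mul_sub, mul_add, mul_smul_comm,
      mul_one, mul_sub]
    abel
  rw [h5, Matrix.trace_sub, Complex.sub_re, Matrix.trace_smul, htr, smul_eq_mul, mul_one,
    Complex.ofReal_re] at h3
  have h6 : (x * (CFC.log x - CFC.log (P x))).trace.re = entropyGap P x := h4
  linarith

theorem continuous_trace_cfc {f : ℝ → ℝ} (hf : Continuous f) {X : ℝ → Matrix m m ℂ}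
    (hX : Continuous X) (hherm : ∀ t, (X t).IsHermitian) :
    Continuous fun t => (cfc f (X t)).trace.re := by
  rw [continuous_iff_continuousAt]
  intro t
  have hn : ContinuousAt (fun r => ‖X r‖ * ‖(1 : Matrix m m ℂ)‖) t := by fun_prop
  have hc : ContinuousAt (fun t => cfc f (X t)) t := by
    refine ContinuousAt.cfc (s := Set.Icc (-(‖X t‖ * ‖(1 : Matrix m m ℂ)‖ + 1))
      (‖X t‖ * ‖(1 : Matrix m m ℂ)‖ + 1)) isCompact_Icc f hX.continuousAt ?_
      (Eventually.of_forall fun s => hherm s) hf.continuousOn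
    filter_upwards [hn.eventually (gt_mem_nhds (lt_add_one _))] with r hr
    exact spectrum_subset_Icc_of_norm_mul_le hr.le
  exact (Complex.continuous_re.comp (traceCLM m).continuous).continuousAt.comp hc

/-- The bound for faithful states extends to all states, as the entropy gap is continuous. -/
theorem IsCommutantExpectation.entropyGap_le_log (hP : IsCommutantExpectation b P)
    (hb : ∀ j, (b j).IsHermitian) {x : Matrix m m ℂ} (hx : x.PosSemidef) (htr : x.trace = 1)
    {α : ℝ} (hα : 0 < α)
    (h : ∀ ρ : Matrix m m ℂ, ρ.PosSemidef → ((α : ℂ) • P ρ - ρ).PosSemidef) :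
    entropyGap P x ≤ Real.log α := by
  rcases isEmpty_or_nonempty m with hm | hm
  · simp [Matrix.trace] at htr
  set K : ℝ := (Fintype.card m : ℝ)
  have hK : 0 < K := Nat.cast_pos.2 Fintype.card_pos
  -- mixing with the maximally mixed state makes `x` faithful
  set X : ℝ → Matrix m m ℂ := fun t => ((1 - t : ℝ) : ℂ) • x + ((t / K : ℝ) : ℂ) • 1
  have hherm : ∀ t, (X t).IsHermitian := fun t => by
    have h1 : ∀ (r : ℝ) {y : Matrix m m ℂ}, y.IsHermitian → ((r : ℂ) • y).IsHermitian :=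
      fun r y hy => by
        rw [Matrix.IsHermitian, Matrix.conjTranspose_smul, hy.eq, Complex.star_def,
          Complex.conj_ofReal]
    exact (h1 _ hx.isHermitian).add (h1 _ Matrix.isHermitian_one)
  have hX : Continuous X := by
    have h1 : Continuous fun t : ℝ => ((1 - t : ℝ) : ℂ) := by fun_prop
    have h2 : Continuous fun t : ℝ => ((t / K : ℝ) : ℂ) := by fun_prop
    exact (h1.smul continuous_const).add (h2.smul continuous_const)
  have hPX : Continuous fun t => P (X t) := (LinearMap.toContinuousLinearMap P).continuous.comp hX
  have hη : Continuous entropyFun := Real.continuous_mul_log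
  have hgap : Continuous fun t => entropyGap P (X t) :=
    (continuous_trace_cfc hη hX hherm).sub
      (continuous_trace_cfc hη hPX fun t => hP.isHermitian hb (hherm t))
  have hX0 : X 0 = x := by simp [X]
  have hlim : Tendsto (fun t => entropyGap P (X t)) (𝓝[>] 0) (𝓝 (entropyGap P x)) := by
    have := hgap.tendsto 0
    rw [hX0] at this
    exact this.mono_left nhdsWithin_le_nhds
  refine le_of_tendsto hlim ?_
  filter_upwards [Ioo_mem_nhdsGT (zero_lt_one' ℝ)] with t ht
  have hpd : (X t).PosDef := Matrix.PosDef.posSemidef_add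
    (hx.smul (by exact_mod_cast (sub_nonneg.2 ht.2.le) : (0 : ℂ) ≤ ((1 - t : ℝ) : ℂ)))
    (posDef_smul_one (div_pos ht.1 hK))
  refine hP.entropyGap_le_log_of_posDef hb hpd ?_ hα (h _ hpd.posSemidef)
  rw [Matrix.trace_add, Matrix.trace_smul, Matrix.trace_smul, htr, Matrix.trace_one, smul_eq_mul,
    smul_eq_mul, mul_one, show ((Fintype.card m : ℕ) : ℂ) = ((K : ℝ) : ℂ) by simp [K],
    ← Complex.ofReal_mul, div_mul_cancel₀ _ hK.ne', ← Complex.ofReal_add]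
  norm_num

theorem ker_le_ker_of_posSemidef_sub {k : Type*} [Fintype k] {x y : Matrix k k ℂ}
    (hx : x.PosSemidef) {c : ℂ}
    (h : (c • y - x).PosSemidef) :
    LinearMap.ker y.mulVecLin ≤ LinearMap.ker x.mulVecLin := by
  intro v hv
  rw [LinearMap.mem_ker, Matrix.mulVecLin_apply] at hv ⊢
  rw [← hx.dotProduct_mulVec_zero_iff]
  have h1 := h.dotProduct_mulVec_nonneg v
  rw [Matrix.sub_mulVec, Matrix.smul_mulVec, hv, smul_zero, zero_sub, dotProduct_neg] at h1
  exact le_antisymm (neg_nonneg.1 h1) (hx.dotProduct_mulVec_nonneg v)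

/-- Comparison of traces gives `α ≥ 1`, so the truncation at `0` in the relative entropy is
harmless. -/
theorem IsCommutantExpectation.relEntropy_le_log (hP : IsCommutantExpectation b P)
    (hb : ∀ j, (b j).IsHermitian) {x : Matrix m m ℂ} (hx : IsState x) {α : ℝ} (hα : 0 < α)
    (h : ∀ ρ : Matrix m m ℂ, ρ.PosSemidef → ((α : ℂ) • P ρ - ρ).PosSemidef) :
    ((relEntropy x (P x) : ℝ≥0∞) : EReal) ≤ ENNReal.log (ENNReal.ofReal α) := by
  have h1 : 1 ≤ α := by
    have := (Complex.le_def.1 (h x hx.1).trace_nonneg).1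
    rw [Matrix.trace_sub, Matrix.trace_smul, hP.trace_map, hx.2] at this
    simpa using this
  rw [hP.relEntropy_eq hb hx.1.isHermitian (ker_le_ker_of_posSemidef_sub hx.1 (h x hx.1)),
    ENNReal.log_ofReal_of_pos hα, EReal.coe_ennreal_ofReal]
  exact EReal.coe_le_coe_iff.2 (max_le (hP.entropyGap_le_log hb hx.1 hx.2 hα h)
    (Real.log_nonneg h1))

/-! ### Amplifications -/

variable {d n : ℕ} {a : ι → Matrix (Fin d) (Fin d) ℂ}

/-- The block of a matrix in `M_n(M_d)` at the position `(i, j)`. -/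
def block (i j : Fin n) :
    Matrix (Fin n × Fin d) (Fin n × Fin d) ℂ →ₗ[ℂ] Matrix (Fin d) (Fin d) ℂ where
  toFun x := x.submatrix (fun k => (i, k)) (fun l => (j, l))
  map_add' _ _ := rfl
  map_smul' _ _ := rfl

theorem block_apply (i j : Fin n) (x : Matrix (Fin n × Fin d) (Fin n × Fin d) ℂ) (k l : Fin d) :
    block i j x k l = x (i, k) (j, l) := rfl

theorem ext_block {x y : Matrix (Fin n × Fin d) (Fin n × Fin d) ℂ}
    (h : ∀ i j, block i j x = block i j y) : x = y := by
  ext p q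
  exact congrFun (congrFun (h p.1 q.1) p.2) q.2

theorem block_amplify (Φ : Matrix (Fin d) (Fin d) ℂ →ₗ[ℂ] Matrix (Fin d) (Fin d) ℂ)
    (x : Matrix (Fin n × Fin d) (Fin n × Fin d) ℂ) (i j : Fin n) :
    block i j (amplify n Φ x) = Φ (block i j x) := rfl

theorem block_one_kronecker_mul (c : Matrix (Fin d) (Fin d) ℂ)
    (x : Matrix (Fin n × Fin d) (Fin n × Fin d) ℂ) (i j : Fin n) :
    block i j (((1 : Matrix (Fin n) (Fin n) ℂ) ⊗ₖ c) * x) = c * block i j x := by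
  ext k l
  simp [block_apply, Matrix.mul_apply, Fintype.sum_prod_type, Matrix.one_apply]

theorem block_mul_one_kronecker (c : Matrix (Fin d) (Fin d) ℂ)
    (x : Matrix (Fin n × Fin d) (Fin n × Fin d) ℂ) (i j : Fin n) :
    block i j (x * ((1 : Matrix (Fin n) (Fin n) ℂ) ⊗ₖ c)) = block i j x * c := by
  ext k l
  simp [block_apply, Matrix.mul_apply, Fintype.sum_prod_type, Matrix.one_apply]

theorem trace_mul_eq_sum_block (x y : Matrix (Fin n × Fin d) (Fin n × Fin d) ℂ) :
    (x * y).trace = ∑ i, ∑ j, (block i j x * block j i y).trace := by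
  simp only [Matrix.trace, Matrix.diag_apply, Matrix.mul_apply, Fintype.sum_prod_type,
    block_apply]
  exact Finset.sum_congr rfl fun i _ => Finset.sum_comm

theorem isHermitian_one_kronecker {c : Matrix (Fin d) (Fin d) ℂ} (hc : c.IsHermitian) :
    ((1 : Matrix (Fin n) (Fin n) ℂ) ⊗ₖ c).IsHermitian := by
  rw [Matrix.IsHermitian, Matrix.conjTranspose_kronecker, Matrix.conjTranspose_one, hc.eq]

theorem mem_fixedAlgebra_iff {x : Matrix (Fin d) (Fin d) ℂ} :
    x ∈ fixedAlgebra a ↔ ∀ j, Commute (a j) x :=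
  forall_congr' fun _ => sub_eq_zero

theorem condExpFix_eq_self {x : Matrix (Fin d) (Fin d) ℂ} (hx : x ∈ fixedAlgebra a) :
    condExpFix a x = x := by
  have h : ((fixedAlgebra a).map (hsEquiv d).toLinearMap).starProjection (hsEquiv d x) =
      hsEquiv d x :=
    Submodule.starProjection_eq_self_iff.2 ⟨x, hx, rfl⟩
  simp only [condExpFix, LinearMap.comp_apply, LinearEquiv.coe_coe]
  erw [h]
  exact (hsEquiv d).symm_apply_apply x

theorem trace_mul_condExpFix_of_mem (ha : ∀ j, (a j).IsHermitian)
    {x y : Matrix (Fin d) (Fin d) ℂ} (hy : y ∈ fixedAlgebra a) :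
    (y * condExpFix a x).trace = (y * x).trace := by
  have h := trace_mul_condExpFix a x yᴴ (mem_fixedAlgebra_iff.2 fun j =>
    commute_conjTranspose (ha j) (mem_fixedAlgebra_iff.1 hy j))
  rwa [Matrix.conjTranspose_conjTranspose] at h

theorem traceDual_condExpFix (ha : ∀ j, (a j).IsHermitian) :
    traceDual (condExpFix a) = condExpFix a := by
  refine LinearMap.ext fun x => Matrix.ext_iff_trace_mul_right.2 fun ρ => ?_
  rw [trace_traceDual_mul, Matrix.trace_mul_comm,
    ← trace_mul_condExpFix_of_mem ha (condExpFix_mem a ρ), Matrix.trace_mul_comm,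
    trace_mul_condExpFix_of_mem ha (condExpFix_mem a x)]

theorem commute_one_kronecker_iff {c : Matrix (Fin d) (Fin d) ℂ}
    {x : Matrix (Fin n × Fin d) (Fin n × Fin d) ℂ} :
    Commute ((1 : Matrix (Fin n) (Fin n) ℂ) ⊗ₖ c) x ↔ ∀ i j, Commute c (block i j x) := by
  constructor
  · intro h i j
    have := congrArg (block i j) h.eq
    rwa [block_one_kronecker_mul, block_mul_one_kronecker] at this
  · intro h
    refine ext_block fun i j => ?_
    rw [block_one_kronecker_mul, block_mul_one_kronecker]
    exact h i j

theorem isCommutantExpectation_amplify (ha : ∀ j, (a j).IsHermitian) (n : ℕ) :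
    IsCommutantExpectation (fun j => (1 : Matrix (Fin n) (Fin n) ℂ) ⊗ₖ a j)
      (amplify n (condExpFix a)) := by
  refine ⟨fun x j => ?_, fun x hx => ext_block fun i k => ?_, fun x y hy => ?_⟩
  · refine commute_one_kronecker_iff.2 fun i k => ?_
    exact mem_fixedAlgebra_iff.1 (condExpFix_mem a (block i k x)) j
  · rw [block_amplify]
    refine condExpFix_eq_self (mem_fixedAlgebra_iff.2 fun j => ?_)
    exact commute_one_kronecker_iff.1 (hx j) i k
  · rw [trace_mul_eq_sum_block, trace_mul_eq_sum_block]
    refine Finset.sum_congr rfl fun i _ => Finset.sum_congr rfl fun k _ => ?_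
    rw [block_amplify]
    refine trace_mul_condExpFix_of_mem ha (mem_fixedAlgebra_iff.2 fun j => ?_)
    exact commute_one_kronecker_iff.1 (hy j) i k

variable [Fintype ι]

theorem amplify_lindbladian (x : Matrix (Fin n × Fin d) (Fin n × Fin d) ℂ) :
    amplify n (lindbladian a) x =
      generator (fun j => (1 : Matrix (Fin n) (Fin n) ℂ) ⊗ₖ a j) x := by
  refine ext_block fun i k => ?_
  rw [block_amplify, generator_apply, map_sum]
  refine Finset.sum_congr rfl fun j _ => ?_
  simp only [dissipator, map_sub, map_add, map_smul, pow_two, mul_assoc, block_one_kronecker_mul]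
  simp only [← mul_assoc, block_mul_one_kronecker]

theorem hasDerivAt_exp_smul_apply {E : Type*} [NormedAddCommGroup E] [NormedSpace ℂ E]
    [CompleteSpace E] (L : E →L[ℂ] E) (v : E) (t : ℝ) :
    HasDerivAt (fun s : ℝ => NormedSpace.exp ((s : ℂ) • L) v)
      (L (NormedSpace.exp ((t : ℂ) • L) v)) t := by
  have h1 := hasDerivAt_exp_smul_const' (𝕂 := ℂ) L (t : ℂ)
  have h2 := (ContinuousLinearMap.apply ℂ E v).hasFDerivAt.comp_hasDerivAt (t : ℂ) h1
  have h3 := h2.scomp t (Complex.ofRealCLM.hasDerivAt (x := t))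
  rw [Complex.ofRealCLM_apply, Complex.ofReal_one, one_smul] at h3
  exact h3

theorem exp_zero_smul_apply {E : Type*} [NormedAddCommGroup E] [NormedSpace ℂ E]
    (L : E →L[ℂ] E) (v : E) : NormedSpace.exp (((0 : ℝ) : ℂ) • L) v = v := by
  rw [Complex.ofReal_zero, zero_smul, NormedSpace.exp_zero]
  rfl

/-- The exponential series is the same over `ℝ` and over `ℂ`. -/
theorem semigroup_eq_exp_complex_smul (t : ℝ) :
    semigroup a t = (NormedSpace.exp ((t : ℂ) • lindbladianCLM a)).toLinearMap := by
  have h : t • lindbladianCLM a = (t : ℂ) • lindbladianCLM a := by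
    ext x k l
    rfl
  rw [semigroup, h]

theorem hasDerivAt_semigroup_apply (x : Matrix (Fin d) (Fin d) ℂ) (t : ℝ) :
    HasDerivAt (fun s => semigroup a s x) (lindbladian a (semigroup a t x)) t := by
  simp only [semigroup_eq_exp_complex_smul]
  exact hasDerivAt_exp_smul_apply (lindbladianCLM a) x t

theorem semigroup_zero_apply (x : Matrix (Fin d) (Fin d) ℂ) : semigroup a 0 x = x := by
  rw [semigroup_eq_exp_complex_smul]
  exact exp_zero_smul_apply (lindbladianCLM a) x

theorem amplify_eq_sum_kronecker (Φ : Matrix (Fin d) (Fin d) ℂ →ₗ[ℂ] Matrix (Fin d) (Fin d) ℂ)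
    (x : Matrix (Fin n × Fin d) (Fin n × Fin d) ℂ) :
    amplify n Φ x = ∑ i, ∑ j, Matrix.single i j (1 : ℂ) ⊗ₖ Φ (block i j x) := by
  ext p q
  simp only [Matrix.sum_apply, Matrix.kroneckerMap_apply, Matrix.single_apply]
  rw [Finset.sum_eq_single p.1 (fun i _ hi => Finset.sum_eq_zero fun j _ => by simp [hi])
    (by simp), Finset.sum_eq_single q.1 (fun j _ hj => by simp [hj]) (by simp)]
  simp only [and_self, if_true, one_mul]
  rfl

theorem hasDerivAt_kronecker (u : Matrix (Fin n) (Fin n) ℂ) {Y : ℝ → Matrix (Fin d) (Fin d) ℂ}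
    {Y' : Matrix (Fin d) (Fin d) ℂ} {t : ℝ} (hY : HasDerivAt Y Y' t) :
    HasDerivAt (fun s => u ⊗ₖ Y s) (u ⊗ₖ Y') t :=
  ((LinearMap.toContinuousLinearMap (Matrix.kroneckerBilinear (R := ℂ) (l := Fin n)
    (m := Fin n) (n := Fin d) (p := Fin d) (α := ℂ) u)).restrictScalars
    ℝ).hasFDerivAt.comp_hasDerivAt t hY

theorem hasDerivAt_amplify_semigroup (x : Matrix (Fin n × Fin d) (Fin n × Fin d) ℂ) (t : ℝ) :
    HasDerivAt (fun s => amplify n (semigroup a s) x)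
      (generator (fun j => (1 : Matrix (Fin n) (Fin n) ℂ) ⊗ₖ a j) (amplify n (semigroup a t) x))
      t := by
  rw [← amplify_lindbladian, amplify_eq_sum_kronecker (lindbladian a)]
  have h : (fun s => amplify n (semigroup a s) x) =
      fun s => ∑ i, ∑ j, Matrix.single i j (1 : ℂ) ⊗ₖ semigroup a s (block i j x) := by
    funext s
    exact amplify_eq_sum_kronecker _ _
  rw [h]
  refine HasDerivAt.fun_sum fun i _ => HasDerivAt.fun_sum fun j _ => ?_
  exact hasDerivAt_kronecker _ (hasDerivAt_semigroup_apply (block i j x) t)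

theorem amplify_semigroup_zero (x : Matrix (Fin n × Fin d) (Fin n × Fin d) ℂ) :
    amplify n (semigroup a 0) x = x :=
  ext_block fun i k => semigroup_zero_apply (block i k x)

theorem conjTranspose_generator {b : ι → Matrix m m ℂ} (hb : ∀ j, (b j).IsHermitian)
    (x : Matrix m m ℂ) : (generator b x)ᴴ = generator b xᴴ := by
  simp only [generator_apply, Matrix.conjTranspose_sum]
  refine Finset.sum_congr rfl fun j _ => ?_
  simp only [dissipator, Matrix.conjTranspose_sub, Matrix.conjTranspose_mul,
    Matrix.conjTranspose_smul, Matrix.conjTranspose_add, pow_two, (hb j).eq, mul_assoc]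
  rw [add_comm (x.conjTranspose * _)]
  norm_num

/-- By uniqueness for the differential equation, as the generator commutes with the adjoint. -/
theorem isHermitian_of_hasDerivAt {b : ι → Matrix m m ℂ} (hb : ∀ j, (b j).IsHermitian)
    {X : ℝ → Matrix m m ℂ} (hX : ∀ t, HasDerivAt X (generator b (X t)) t)
    (h0 : (X 0).IsHermitian) (t : ℝ) : (X t).IsHermitian := by
  have hlip := (LinearMap.toContinuousLinearMap (generator b)).lipschitz
  have := ODE_solution_unique_univ (v := fun _ => generator b) (s := fun _ => Set.univ)
    (f := fun t => (X t)ᴴ) (g := X) (t₀ := 0) (fun _ => hlip.lipschitzOnWith)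
    (fun t => ⟨by
      have h := (hX t).star
      rw [Matrix.star_eq_conjTranspose, conjTranspose_generator hb] at h
      exact h, Set.mem_univ _⟩)
    (fun t => ⟨hX t, Set.mem_univ _⟩) h0
  exact congrFun this t

end

noncomputable section
open Filter Topology

/-! ### The estimates for the amplified semigroup -/

variable {ι : Type*} {d n : ℕ} {a : ι → Matrix (Fin d) (Fin d) ℂ}

theorem isHermitian_amplified (ha : ∀ j, (a j).IsHermitian) (n : ℕ) (j : ι) :
    ((1 : Matrix (Fin n) (Fin n) ℂ) ⊗ₖ a j).IsHermitian :=
  isHermitian_one_kronecker (ha j)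

theorem norm_commutator_le_one [Finite ι] {f : Matrix (Fin n × Fin d) (Fin n × Fin d) ℂ}
    (hf : lipNorm a n f ≤ 1) (j : ι) :
    ‖((1 : Matrix (Fin n) (Fin n) ℂ) ⊗ₖ a j) * f - f * ((1 : Matrix (Fin n) (Fin n) ℂ) ⊗ₖ a j)‖
      ≤ 1 :=
  (le_ciSup (Set.finite_range fun j => ‖((1 : Matrix (Fin n) (Fin n) ℂ) ⊗ₖ a j) * f -
    f * ((1 : Matrix (Fin n) (Fin n) ℂ) ⊗ₖ a j)‖).bddAbove j).trans hf

/-- Every admissible constant in the index is at least `exp D(ρ‖E ρ)`. -/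
theorem maxRelEntropy_le_log_completeIndex (ha : ∀ j, (a j).IsHermitian) :
    maxRelEntropy a ≤ (ENNReal.log (completeIndex a)).toENNReal := by
  refine iSup₂_le fun n hn => iSup₂_le fun ρ hρ => ?_
  have h1 : EReal.exp (relEntropy ρ (amplify n (condExpFix a) ρ) : ℝ≥0∞) ≤ index a n := by
    refine le_iInf fun α => le_iInf₂ fun hα h => ?_
    rw [traceDual_condExpFix ha] at h
    have h2 := (isCommutantExpectation_amplify ha n).relEntropy_le_log
      (isHermitian_amplified ha n) hρ hα h
    have h3 := EReal.exp_monotone h2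
    rwa [ENNReal.exp_log] at h3
  have h2 : index a n ≤ completeIndex a := le_iSup₂ (f := fun n (_ : 1 ≤ n) => index a n) n hn
  have h3 := ENNReal.log_monotone (h1.trans h2)
  rw [EReal.log_exp] at h3
  have h4 := EReal.toENNReal_le_toENNReal h3
  rwa [EReal.toENNReal_coe] at h4

theorem expectedLength_eq_completeComplexity :
    expectedLength a = completeComplexity a (condExpFix a) := by
  have h : ∀ (n : ℕ) (f : Matrix (Fin n × Fin d) (Fin n × Fin d) ℂ),
      amplify n (traceDual (condExpFix a) - LinearMap.id) f =
        amplify n (traceDual (condExpFix a)) f - f := fun n f => rfl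
  simp only [expectedLength, completeComplexity, h]

variable [Fintype ι]

theorem isHermitian_amplify_semigroup (ha : ∀ j, (a j).IsHermitian)
    {ρ : Matrix (Fin n × Fin d) (Fin n × Fin d) ℂ} (hρ : ρ.IsHermitian) (t : ℝ) :
    (amplify n (semigroup a t) ρ).IsHermitian :=
  isHermitian_of_hasDerivAt (isHermitian_amplified ha n) (hasDerivAt_amplify_semigroup ρ)
    (by rwa [amplify_semigroup_zero]) t

theorem amplify_condExpFix_semigroup (ha : ∀ j, (a j).IsHermitian)
    (ρ : Matrix (Fin n × Fin d) (Fin n × Fin d) ℂ) (t : ℝ) :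
    amplify n (condExpFix a) (amplify n (semigroup a t) ρ) = amplify n (condExpFix a) ρ := by
  have h := (isCommutantExpectation_amplify ha n).map_eq_map_zero (isHermitian_amplified ha n)
    (hasDerivAt_amplify_semigroup ρ) t
  rwa [amplify_semigroup_zero] at h

theorem isState_amplify_semigroup (ha : ∀ j, (a j).IsHermitian)
    {ρ : Matrix (Fin n × Fin d) (Fin n × Fin d) ℂ} (hρ : IsState ρ) {t : ℝ} (ht : 0 ≤ t) :
    IsState (amplify n (semigroup a t) ρ) := by
  have hP := isCommutantExpectation_amplify ha n
  have hherm := isHermitian_amplify_semigroup ha hρ.1.isHermitian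
  constructor
  · rw [(hherm t).posSemidef_iff_eigenvalues_nonneg]
    intro k
    refine spectrum_subset_Ici_of_hasDerivAt (isHermitian_amplified ha n)
      (hasDerivAt_amplify_semigroup ρ) hherm ?_ ht ((hherm t).eigenvalues_mem_spectrum_real k)
    rw [amplify_semigroup_zero, hρ.1.isHermitian.spectrum_real_eq_range_eigenvalues]
    rintro _ ⟨k, rfl⟩
    exact hρ.1.eigenvalues_nonneg k
  · rw [← hP.trace_map, amplify_condExpFix_semigroup ha, hP.trace_map, hρ.2]

theorem norm_trace_mul_sq_mul_le_of_satisfiesMLSI (ha : ∀ j, (a j).IsHermitian) {lam : ℝ}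
    (hlam : 0 < lam) (hM : SatisfiesMLSI a n lam)
    {f ρ : Matrix (Fin n × Fin d) (Fin n × Fin d) ℂ} (hPf : amplify n (condExpFix a) f = 0)
    (hf : lipNorm a n f ≤ 1) (hρ : ρ.PosDef) (htr : ρ.trace = 1) :
    ‖(f * ρ).trace‖ ^ 2 * lam ≤
      2 * (Fintype.card ι : ℝ) * entropyGap (amplify n (condExpFix a)) ρ := by
  have hP := isCommutantExpectation_amplify ha n
  have hb := isHermitian_amplified ha n
  have h := norm_trace_mul_sq_mul_le hP hb (hasDerivAt_amplify_semigroup ρ)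
    (isHermitian_amplify_semigroup ha hρ.isHermitian) (by rwa [amplify_semigroup_zero])
    (by rwa [amplify_semigroup_zero]) hlam (fun t ht hpos => ?_) hPf (norm_commutator_le_one hf)
  · rwa [amplify_semigroup_zero] at h
  · have h1 := hM t ht ρ ⟨hρ.posSemidef, htr⟩
    rw [← amplify_condExpFix_semigroup ha ρ t, hP.relEntropy_eq_of_posDef hb (hpos t ht),
      amplify_condExpFix_semigroup ha ρ t, hP.relEntropy_eq_of_posDef hb hρ,
      ← ENNReal.ofReal_mul (Real.exp_pos _).le] at h1
    rw [amplify_semigroup_zero]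
    exact (ENNReal.ofReal_le_ofReal_iff
      (mul_nonneg (Real.exp_pos _).le (hP.entropyGap_nonneg hb hρ))).1 h1

/-- The transport estimate with the best constant. The right side has the finite entropy of the
single state `ρ`, which is what is needed when `clsi a = ∞`. -/
theorem ofReal_sq_mul_clsi_le (ha : ∀ j, (a j).IsHermitian) (hn : 1 ≤ n)
    {f ρ : Matrix (Fin n × Fin d) (Fin n × Fin d) ℂ} (hPf : amplify n (condExpFix a) f = 0)
    (hf : lipNorm a n f ≤ 1) (hρ : ρ.PosDef) (htr : ρ.trace = 1) :
    ENNReal.ofReal (‖(f * ρ).trace‖ ^ 2) * clsi a ≤ 2 * (Fintype.card ι : ℝ≥0∞) *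
      ENNReal.ofReal (entropyGap (amplify n (condExpFix a)) ρ) := by
  rw [clsi]
  simp only [ENNReal.mul_iSup]
  refine iSup_le fun lam => iSup₂_le fun hlam hM => ?_
  have h := norm_trace_mul_sq_mul_le_of_satisfiesMLSI ha hlam (hM n hn) hPf hf hρ htr
  rw [← ENNReal.ofReal_mul (sq_nonneg _)]
  refine (ENNReal.ofReal_le_ofReal h).trans (le_of_eq ?_)
  rw [ENNReal.ofReal_mul (by positivity), ENNReal.ofReal_mul zero_le_two, ENNReal.ofReal_natCast,
    ENNReal.ofReal_ofNat]

/-- Without relative entropy every rate of decay is admissible. -/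
theorem clsi_eq_top_of_maxRelEntropy_eq_zero (ha : ∀ j, (a j).IsHermitian)
    (h : maxRelEntropy a = 0) : clsi a = ∞ := by
  have hM : ∀ lam : ℝ, ∀ n : ℕ, 1 ≤ n → SatisfiesMLSI a n lam := by
    intro lam n hn t ht ρ hρ
    have h1 : relEntropy (amplify n (semigroup a t) ρ)
        (amplify n (condExpFix a) (amplify n (semigroup a t) ρ)) ≤ maxRelEntropy a := by
      rw [maxRelEntropy]
      exact le_iSup₂_of_le n hn (le_iSup₂_of_le _ (isState_amplify_semigroup ha hρ ht) le_rfl)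
    rw [amplify_condExpFix_semigroup ha, h] at h1
    exact h1.trans bot_le
  refine ENNReal.eq_top_of_forall_nnreal_le fun r => ?_
  rw [clsi]
  refine le_iSup_of_le ((r : ℝ) + 1) (le_iSup₂_of_le (by positivity) (hM _) ?_)
  rw [← ENNReal.ofReal_coe_nnreal]
  exact ENNReal.ofReal_le_ofReal (by linarith)

/-- The cases `clsi a = 0` and `clsi a = ∞` are consistent with the conventions of division in
`ℝ≥0∞`. -/
theorem ofReal_sq_le_div (ha : ∀ j, (a j).IsHermitian) (hn : 1 ≤ n)
    {f ρ : Matrix (Fin n × Fin d) (Fin n × Fin d) ℂ} (hPf : amplify n (condExpFix a) f = 0)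
    (hf : lipNorm a n f ≤ 1) (hρ : ρ.PosDef) (htr : ρ.trace = 1) :
    ENNReal.ofReal (‖(f * ρ).trace‖ ^ 2) ≤
      2 * (Fintype.card ι : ℝ≥0∞) * maxRelEntropy a / clsi a := by
  have hP := isCommutantExpectation_amplify ha n
  have hb := isHermitian_amplified ha n
  have hmain := ofReal_sq_mul_clsi_le ha hn hPf hf hρ htr
  have hle : ENNReal.ofReal (entropyGap (amplify n (condExpFix a)) ρ) ≤ maxRelEntropy a := by
    rw [← hP.relEntropy_eq_of_posDef hb hρ, maxRelEntropy]
    exact le_iSup₂_of_le n hn (le_iSup₂_of_le ρ ⟨hρ.posSemidef, htr⟩ le_rfl)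
  rcases isEmpty_or_nonempty ι with hι | hι
  · -- all matrices are fixed, so `f = 0`
    have h0 : f = 0 := by rw [← hP.map_eq f fun j => hι.elim j, hPf]
    simp [h0]
  rcases eq_or_ne (clsi a) ∞ with htop | htop
  · -- the entropy of `ρ` is finite, so the pairing vanishes
    rw [htop] at hmain
    have hfin : 2 * (Fintype.card ι : ℝ≥0∞) *
        ENNReal.ofReal (entropyGap (amplify n (condExpFix a)) ρ) < ∞ :=
      ENNReal.mul_lt_top (ENNReal.mul_lt_top ENNReal.ofNat_lt_top (ENNReal.natCast_lt_top _))
        ENNReal.ofReal_lt_top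
    by_cases h0 : ENNReal.ofReal (‖(f * ρ).trace‖ ^ 2) = 0
    · rw [h0]
      exact bot_le
    · rw [ENNReal.mul_top h0] at hmain
      exact absurd hmain (not_le.2 hfin)
  rcases eq_or_ne (clsi a) 0 with hzero | hzero
  · have hne : 2 * (Fintype.card ι : ℝ≥0∞) * maxRelEntropy a ≠ 0 := by
      refine mul_ne_zero (mul_ne_zero two_ne_zero ?_) fun h => ?_
      · exact Nat.cast_ne_zero.2 Fintype.card_ne_zero
      · exact htop (clsi_eq_top_of_maxRelEntropy_eq_zero ha h)
    rw [hzero, ENNReal.div_zero hne]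
    exact le_top
  · rw [ENNReal.le_div_iff_mul_le (Or.inl hzero) (Or.inl htop)]
    exact hmain.trans (mul_le_mul_right hle _)

theorem enorm_le_four_mul_rpow (ha : ∀ j, (a j).IsHermitian) (hn : 1 ≤ n)
    {f : Matrix (Fin n × Fin d) (Fin n × Fin d) ℂ} (hPf : amplify n (condExpFix a) f = 0)
    (hf : lipNorm a n f ≤ 1) :
    ‖f‖ₑ ≤ 4 * (2 * (Fintype.card ι : ℝ≥0∞) * maxRelEntropy a / clsi a) ^ (1 / 2 : ℝ) := by
  set Q := 2 * (Fintype.card ι : ℝ≥0∞) * maxRelEntropy a / clsi a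
  rcases eq_or_ne (Q ^ (1 / 2 : ℝ)) ∞ with htop | htop
  · rw [htop, ENNReal.mul_top (by norm_num)]
    exact le_top
  have hstate : ∀ ρ : Matrix (Fin n × Fin d) (Fin n × Fin d) ℂ, ρ.PosDef → ρ.trace = 1 →
      ‖(f * ρ).trace‖ ≤ (Q ^ (1 / 2 : ℝ)).toReal := by
    intro ρ hρ htr
    have h1 := ENNReal.rpow_le_rpow (ofReal_sq_le_div ha hn hPf hf hρ htr)
      (by norm_num : (0 : ℝ) ≤ 1 / 2)
    rw [ENNReal.ofReal_rpow_of_nonneg (sq_nonneg _) (by norm_num), ← Real.sqrt_eq_rpow,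
      Real.sqrt_sq (norm_nonneg _)] at h1
    exact (ENNReal.ofReal_le_iff_le_toReal htop).1 h1
  have h2 := norm_le_four_mul_of_forall_state ENNReal.toReal_nonneg hstate
  rw [← ofReal_norm]
  refine (ENNReal.ofReal_le_ofReal h2).trans (le_of_eq ?_)
  rw [ENNReal.ofReal_mul (by norm_num), ENNReal.ofReal_toReal htop, ENNReal.ofReal_ofNat]

theorem expectedLength_le (ha : ∀ j, (a j).IsHermitian) :
    expectedLength a ≤
      4 * (2 * (Fintype.card ι : ℝ≥0∞) * maxRelEntropy a / clsi a) ^ (1 / 2 : ℝ) := by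
  refine iSup₂_le fun n hn => iSup₂_le fun f hPf => iSup_le fun hf => ?_
  rw [traceDual_condExpFix ha, hPf, zero_sub, enorm_neg]
  exact enorm_le_four_mul_rpow ha hn hPf hf

end
end LipschitzComplexity

theorem mainTheorem5 {ι : Type*} [Fintype ι] (d : ℕ) (hd : 1 ≤ d)
    (a : ι → Matrix (Fin d) (Fin d) ℂ) (ha : ∀ j, (a j).IsHermitian) :
    LipschitzComplexity.expectedLength a =
        LipschitzComplexity.completeComplexity a (LipschitzComplexity.condExpFix a) ∧
      LipschitzComplexity.expectedLength a ≤
        4 * (2 * (Fintype.card ι : ℝ≥0∞) * LipschitzComplexity.maxRelEntropy a /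
          LipschitzComplexity.clsi a) ^ (1 / 2 : ℝ) ∧
      4 * (2 * (Fintype.card ι : ℝ≥0∞) * LipschitzComplexity.maxRelEntropy a /
          LipschitzComplexity.clsi a) ^ (1 / 2 : ℝ) ≤
        4 * (2 * (Fintype.card ι : ℝ≥0∞) *
          (ENNReal.log (LipschitzComplexity.completeIndex a)).toENNReal /
          LipschitzComplexity.clsi a) ^ (1 / 2 : ℝ) := by
  refine ⟨LipschitzComplexity.expectedLength_eq_completeComplexity,
    LipschitzComplexity.expectedLength_le ha, ?_⟩
  gcongr
  exact LipschitzComplexity.maxRelEntropy_le_log_completeIndex ha
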